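/- Let $n,d,K$ be non-negative integers with $n>d+1$, let $\Sigma\in\mathbb R^{d\times d}$ be symmetric positive definite, $\theta_0\in\mathbb R^d$, $\sigma\in\mathbb R$, and let $P$ be a probability distribution on $\mathbb R^K$ whose coordinates have finite second moments, the $i$-th coordinate having mean $p_i$ and variance $s_i$. Let $x_1,\dots,x_n$ be independent draws from $\mathcal N(0,\Sigma)$ in $\mathbb R^d$; let $\eta_1,\dots,\eta_n$ be square-integrable real random variables with $\mathbb E[\eta_t]=0$ and $\mathrm{Var}[\eta_t]=\sigma^2$, such that $(\eta_t)_{t\le n}$ is independent of $(x_t)_{t\le n}$; and let $a_1,\dots,a_n$ be independent draws from $P$, such that $(a_t)_{t\le n}$ is independent of $(x_t,\eta_t)_{t\le n}$. The root of a 2-level hierarchy has the value $y_{t,0}=\theta_0^\top x_t+\eta_t$ at time $t$, and its $i$-th child ($1\le i\le K$) has the value $y_{t,i}=a_{t,i}\,y_{t,0}$. Put $\theta_i=p_i\theta_0$ and, for an estimator $\hat\theta_i$ of $\theta_i$, let $r(\hat\theta_i)=(\hat\theta_i-\theta_i)^\top\Sigma(\hat\theta_i-\theta_i)$ be its excess risk.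 (1) Bottom-up. Let $\hat\theta_i^{\mathbf b}=\bigl(\sum_{t=1}^n x_tx_t^\top\bigr)^{-1}\sum_{t=1}^n x_t\,y_{t,i}$ be the ordinary least squares estimator fitted to the $i$-th child. Then each $r(\hat\theta_i^{\mathbf b})$ is integrable and $$\sum_{i=1}^K\mathbb E\bigl[r(\hat\theta_i^{\mathbf b})\bigr]\ \ge\ \sum_{i=1}^K(s_i+p_i^2)\,\frac{d}{n-d-1}\,\sigma^2 .$$ (2) Top-down. Assume that $\theta_0\ne0$ or that $\eta_t\neq 0$ almost surely for every $t$ (so that $y_{t,0}\ne0$ almost surely). Let $\hat\theta_0^{\mathbf t}=\bigl(\sum_{t=1}^n x_tx_t^\top\bigr)^{-1}\sum_{t=1}^n x_t\,y_{t,0}$, $\hat p_i=\frac1n\sum_{t=1}^n\frac{y_{t,i}}{y_{t,0}}$ and $\hat\theta_i^{\mathbf t}=\hat p_i\,\hat\theta_0^{\mathbf t}$. Then each $r(\hat\theta_i^{\mathbf t})$ is integrable and $$\sum_{i=1}^K\mathbb E\bigl[r(\hat\theta_i^{\mathbf t})\bigr]=\frac{\sum_{i=1}^K s_i}{n}\,\theta_0^\top\Sigma\theta_0+\Bigl(\frac{\sum_{i=1}^K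 s_i}{n}+\sum_{i=1}^K p_i^2\Bigr)\frac{d}{n-d-1}\,\sigma^2 .$$ -/

import Mathlib

open MeasureTheory ProbabilityTheory
open scoped Matrix

noncomputable section

namespace TwoLevel

variable {n d K : ℕ}

/-- Value of the root node: `y₀ = θ₀ᵀ x + η`. -/
def rootValue (θ₀ : Fin d → ℝ) (x : EuclideanSpace ℝ (Fin d)) (η : ℝ) : ℝ :=
  θ₀ ⬝ᵥ x.ofLp + η

/-- Value of a child node with proportion `a`: `a * y₀`. -/
def childValue (θ₀ : Fin d → ℝ) (x : EuclideanSpace ℝ (Fin d)) (η a : ℝ) : ℝ :=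
  a * rootValue θ₀ x η

/-- The matrix `∑ₜ xₜ xₜᵀ`. -/
def gram (x : Fin n → EuclideanSpace ℝ (Fin d)) : Matrix (Fin d) (Fin d) ℝ :=
  ∑ t, Matrix.vecMulVec (x t).ofLp (x t).ofLp

/-- The ordinary least squares estimator `(∑ₜ xₜ xₜᵀ)⁻¹ ∑ₜ xₜ yₜ`. -/
def ols (x : Fin n → EuclideanSpace ℝ (Fin d)) (y : Fin n → ℝ) : Fin d → ℝ :=
  (gram x)⁻¹ *ᵥ ∑ t, y t • (x t).ofLp

/-- Bottom-up estimator of the `i`-th child: OLS on the data of that child. -/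
def bottomUp (θ₀ : Fin d → ℝ) (x : Fin n → EuclideanSpace ℝ (Fin d)) (η : Fin n → ℝ)
    (a : Fin n → Fin K → ℝ) (i : Fin K) : Fin d → ℝ :=
  ols x fun t => childValue θ₀ (x t) (η t) (a t i)

/-- Empirical mean proportion `p̂ᵢ = (1/n) ∑ₜ y_{t,i} / y_{t,0}`. -/
def meanProportion (θ₀ : Fin d → ℝ) (x : Fin n → EuclideanSpace ℝ (Fin d)) (η : Fin n → ℝ)
    (a : Fin n → Fin K → ℝ) (i : Fin K) : ℝ :=
  1 / (n : ℝ) * ∑ t, childValue θ₀ (x t) (η t) (a t i) / rootValue θ₀ (x t) (η t)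

/-- Top-down estimator of the `i`-th child: `p̂ᵢ` times the OLS estimator of the root. -/
def topDown (θ₀ : Fin d → ℝ) (x : Fin n → EuclideanSpace ℝ (Fin d)) (η : Fin n → ℝ)
    (a : Fin n → Fin K → ℝ) (i : Fin K) : Fin d → ℝ :=
  meanProportion θ₀ x η a i • ols x fun t => rootValue θ₀ (x t) (η t)

/-- Excess risk `(θ̂ - θ)ᵀ S (θ̂ - θ)` of an estimate `θ̂` of the coefficients `θ`. -/
def excessRisk (S : Matrix (Fin d) (Fin d) ℝ) (θ θhat : Fin d → ℝ) : ℝ :=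
  (θhat - θ) ⬝ᵥ S *ᵥ (θhat - θ)

end TwoLevel

end

/-!
Write `A = S^{1/2}`, `xₜ = A zₜ` with `zₜ` standard Gaussian, `Z` for the matrix with rows `zₜ`,
`G = ZᵀZ`, `wₜ = G⁻¹ zₜ` and `β = A θ₀`. The excess risk of an estimate `θ̂` is `‖A θ̂ - pᵢ β‖²`, and
`A` maps the least squares estimator with responses `yₜ` to `∑ₜ yₜ wₜ` (`mulVec_ols`). As
`∑ₜ (βᵀzₜ) wₜ = β`, the errors of the two estimators are

* bottom-up: `∑ₜ (aₜ - p) (βᵀzₜ) wₜ + ∑ₜ aₜ ηₜ wₜ`,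
* top-down: `(p̂ - p) β + p̂ ∑ₜ ηₜ wₜ`, because `p̂` is almost surely the mean of the `aₜ`.

In both cases the two summands are uncorrelated, since `ηₜ` is centred and independent of everything
else. The noise variables may be correlated with each other, but flipping the sign of one row of `Z`
shows that different `wₜ` are uncorrelated (`integral_olsWeight_mul_of_ne`). Hence
`E ‖∑ₜ cₜ wₜ‖² = κ E tr G⁻¹` for coefficients `cₜ` with `E cₜ² = κ` that are independent of `Z`
(`sum_integral_sq_sum_mul_olsWeight`), and everything is reduced to the mean of the inverse Wishart
distribution, `E tr G⁻¹ = d / (n - d - 1)` (`integral_trace_inv_gram`).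

This mean comes from Gaussian integration by parts. For `H = (G + ε)⁻¹`, Stein's identity applied to
every entry of `Z H` gives `E tr(GH) = E [n tr H - tr(HGH) - tr(GH) tr H]`. All terms are bounded for
`ε > 0`. Since `tr(GH) ≤ d` and `tr(HGH) ≤ tr H`, it follows that `(n - d - 1) E tr H ≤ d` uniformly
in `ε`, so by Fatou `G` is almost surely invertible and `tr G⁻¹` is integrable; dominated convergence
as `ε → 0` then turns the identity into `d = (n - d - 1) E tr G⁻¹`. Stein's identity applied to the
products `zₜᵢ tr H` gives `E ‖zₜ‖² tr H ≤ d E tr H`, which makes the first summand of the bottom-up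
error square integrable.
-/

namespace TwoLevel

open Filter Topology

/-! ### Stein's identity -/

/-- Resampling one coordinate of a product probability measure does not change its law. -/
lemma measurePreserving_update {ι : Type*} [Fintype ι] [DecidableEq ι] {X : ι → Type*}
    [∀ i, MeasurableSpace (X i)] (ν : ∀ i, Measure (X i)) [∀ i, IsProbabilityMeasure (ν i)]
    (j : ι) :
    MeasurePreserving (fun q : (∀ i, X i) × X j => Function.update q.1 j q.2)
      ((Measure.pi ν).prod (ν j)) (Measure.pi ν) := by
  have hm : Measurable (fun q : (∀ i, X i) × X j => Function.update q.1 j q.2) := by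
    refine measurable_pi_lambda _ fun i => ?_
    by_cases h : i = j
    · subst h; simpa using measurable_snd
    · simp only [Function.update_of_ne h]
      exact (measurable_pi_apply i).comp measurable_fst
  refine ⟨hm, (Measure.pi_eq fun s hs => ?_).symm⟩
  rw [Measure.map_apply hm (MeasurableSet.univ_pi hs)]
  have : (fun q : (∀ i, X i) × X j => Function.update q.1 j q.2) ⁻¹' (Set.univ.pi s) =
      (Set.univ.pi (Function.update s j Set.univ)) ×ˢ s j := by
    ext ⟨z, y⟩
    simp only [Set.mem_preimage, Set.mem_pi, Set.mem_univ, forall_true_left, Set.mem_prod]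
    constructor
    · intro h
      refine ⟨fun i => ?_, by simpa using h j⟩
      by_cases hi : i = j
      · subst hi; simp
      · simpa [Function.update_of_ne hi] using h i
    · rintro ⟨h1, h2⟩ i
      by_cases hi : i = j
      · subst hi; simpa using h2
      · simpa [Function.update_of_ne hi] using h1 i
  rw [this, Measure.prod_prod, Measure.pi_pi, ← Finset.mul_prod_erase _ _ (Finset.mem_univ j),
    ← Finset.mul_prod_erase _ (fun i => ν i (s i)) (Finset.mem_univ j)]
  simp only [Function.update_self, measure_univ, one_mul]
  rw [mul_comm]
  congr 1
  refine Finset.prod_congr rfl fun i hi => ?_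
  rw [Function.update_of_ne (Finset.ne_of_mem_erase hi)]

lemma integrable_gaussianReal_iff {f : ℝ → ℝ} :
    Integrable f (gaussianReal 0 1) ↔ Integrable fun x => gaussianPDFReal 0 1 x * f x := by
  rw [gaussianReal_of_var_ne_zero _ one_ne_zero,
    integrable_withDensity_iff_integrable_smul' (measurable_gaussianPDF _ _)
      (ae_of_all _ fun _ => gaussianPDF_lt_top)]
  simp [toReal_gaussianPDF]

lemma hasDerivAt_gaussianPDFReal (x : ℝ) :
    HasDerivAt (gaussianPDFReal 0 1) (-(x * gaussianPDFReal 0 1 x)) x := by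
  simp only [gaussianPDFReal_def]
  have h : HasDerivAt (fun y : ℝ => -(y - 0) ^ 2 / (2 * ((1 : NNReal) : ℝ))) (-x) x := by
    have := (((hasDerivAt_id x).sub_const 0).pow 2).neg.div_const (2 * ((1 : NNReal) : ℝ))
    refine this.congr_deriv ?_
    simp; ring
  refine (h.exp.const_mul _).congr_deriv ?_
  ring

/-- Stein's identity for the standard Gaussian distribution on the real line. -/
lemma integral_mul_gaussianReal {f f' : ℝ → ℝ} (hf : ∀ x, HasDerivAt f (f' x) x)
    (h0 : Integrable f (gaussianReal 0 1)) (h1 : Integrable f' (gaussianReal 0 1))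
    (h2 : Integrable (fun x => x * f x) (gaussianReal 0 1)) :
    ∫ x, x * f x ∂gaussianReal 0 1 = ∫ x, f' x ∂gaussianReal 0 1 := by
  rw [integral_gaussianReal_eq_integral_smul one_ne_zero,
    integral_gaussianReal_eq_integral_smul one_ne_zero]
  rw [integrable_gaussianReal_iff] at h0 h1 h2
  have := integral_mul_deriv_eq_deriv_mul_of_integrable (u := f) (u' := f')
    (v := gaussianPDFReal 0 1) (v' := fun x => -(x * gaussianPDFReal 0 1 x))
    (fun x _ => hf x) (fun x _ => hasDerivAt_gaussianPDFReal x)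
    (h2.neg.congr (ae_of_all _ fun x => by simp; ring))
    (h1.congr (ae_of_all _ fun x => by simp; ring))
    (h0.congr (ae_of_all _ fun x => by simp; ring))
  calc _ = -∫ x, f x * -(x * gaussianPDFReal 0 1 x) := by
        rw [← integral_neg]; congr 1; ext x; simp; ring
    _ = _ := by rw [this, neg_neg]; congr 1; ext x; simp; ring

/-- Stein's identity in one coordinate of a standard Gaussian vector. -/
lemma integral_mul_pi_gaussianReal {ι : Type*} [Fintype ι] [DecidableEq ι] (k : ι)
    {f g : (ι → ℝ) → ℝ}
    (hf : ∀ z, HasDerivAt (fun s => f (Function.update z k s)) (g z) (z k))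
    (h0 : Integrable f (Measure.pi fun _ => gaussianReal 0 1))
    (h1 : Integrable g (Measure.pi fun _ => gaussianReal 0 1))
    (h2 : Integrable (fun z => z k * f z) (Measure.pi fun _ => gaussianReal 0 1)) :
    ∫ z, z k * f z ∂(Measure.pi fun _ => gaussianReal 0 1) =
      ∫ z, g z ∂(Measure.pi fun _ => gaussianReal 0 1) := by
  have mp := measurePreserving_update (fun _ : ι => gaussianReal 0 1) k
  have key : ∀ {F : (ι → ℝ) → ℝ}, Integrable F (Measure.pi fun _ => gaussianReal 0 1) →
      ∫ z, F z ∂(Measure.pi fun _ => gaussianReal 0 1) =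
        ∫ z, ∫ s, F (Function.update z k s) ∂gaussianReal 0 1
          ∂(Measure.pi fun _ => gaussianReal 0 1) := by
    intro F hF
    have hF' := mp.integrable_comp_of_integrable hF
    have e := integral_prod _ hF'
    simp only [Function.comp_apply] at e
    rw [← e]
    conv_lhs => rw [← mp.map_eq]
    rw [integral_map mp.measurable.aemeasurable]
    rw [mp.map_eq]
    exact hF.1
  rw [key h2, key h1]
  refine integral_congr_ae ?_
  filter_upwards [(mp.integrable_comp_of_integrable h0).prod_right_ae,
    (mp.integrable_comp_of_integrable h1).prod_right_ae,
    (mp.integrable_comp_of_integrable h2).prod_right_ae] with z i0 i1 i2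
  simp only [Function.comp_apply, Function.update_self] at i0 i1 i2 ⊢
  refine integral_mul_gaussianReal (fun s => ?_) i0 i1 i2
  simpa using hf (Function.update z k s)

/-! ### The regularised inverse Gram matrix -/

lemma dotProduct_self_eq_sum_sq {κ : Type*} [Fintype κ] (v : κ → ℝ) : v ⬝ᵥ v = ∑ k, v k ^ 2 := by
  simp [dotProduct, sq]

lemma real_dotProduct_self_nonneg {κ : Type*} [Fintype κ] (v : κ → ℝ) : 0 ≤ v ⬝ᵥ v := by
  rw [dotProduct_self_eq_sum_sq]; positivity

section MatrixAlgebra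

variable {m ι : Type*} [Fintype m] [Fintype ι] [DecidableEq ι]

/-- The regularised inverse Gram matrix `(ZᵀZ + ε)⁻¹`. -/
noncomputable def ridge (Z : Matrix m ι ℝ) (ε : ℝ) : Matrix ι ι ℝ := (Zᵀ * Z + ε • 1)⁻¹

lemma ridge_zero (Z : Matrix m ι ℝ) : ridge Z 0 = (Zᵀ * Z)⁻¹ := by simp [ridge]

lemma isUnit_det_ridge (Z : Matrix m ι ℝ) {ε : ℝ} (hε : 0 < ε) :
    IsUnit (Zᵀ * Z + ε • (1 : Matrix ι ι ℝ)).det := by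
  have h1 : (Zᵀ * Z).PosSemidef := by
    simpa [Matrix.conjTranspose_eq_transpose_of_trivial] using
      Matrix.posSemidef_conjTranspose_mul_self Z
  have h2 : (ε • (1 : Matrix ι ι ℝ)).PosDef := Matrix.PosDef.one.smul hε
  exact (Matrix.PosDef.posSemidef_add h1 h2).det_pos.ne'.isUnit

lemma ridge_transpose (Z : Matrix m ι ℝ) (ε : ℝ) : (ridge Z ε)ᵀ = ridge Z ε := by
  simp [ridge, Matrix.transpose_nonsing_inv]

lemma ridge_symm (Z : Matrix m ι ℝ) (ε : ℝ) (i j : ι) : ridge Z ε i j = ridge Z ε j i := by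
  conv_lhs => rw [← ridge_transpose, Matrix.transpose_apply]

lemma dotProduct_gram_mulVec (Z : Matrix m ι ℝ) (ε : ℝ) (u v : ι → ℝ) :
    u ⬝ᵥ (Zᵀ * Z + ε • 1) *ᵥ v = (Z *ᵥ u) ⬝ᵥ (Z *ᵥ v) + ε * (u ⬝ᵥ v) := by
  rw [Matrix.add_mulVec, dotProduct_add, ← Matrix.mulVec_mulVec, Matrix.dotProduct_mulVec,
    Matrix.vecMul_transpose, Matrix.smul_mulVec, Matrix.one_mulVec, dotProduct_smul, smul_eq_mul]

lemma dotProduct_ridge_mulVec {Z : Matrix m ι ℝ} {ε : ℝ}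
    (h : IsUnit (Zᵀ * Z + ε • (1 : Matrix ι ι ℝ)).det) (u v : ι → ℝ) :
    (Z *ᵥ u) ⬝ᵥ (Z *ᵥ (ridge Z ε *ᵥ v)) + ε * (u ⬝ᵥ (ridge Z ε *ᵥ v)) = u ⬝ᵥ v := by
  rw [← dotProduct_gram_mulVec, ridge, Matrix.mulVec_mulVec, Matrix.mul_nonsing_inv _ h,
    Matrix.one_mulVec]

/-- Variational characterisation of the quadratic form of `(ZᵀZ + ε)⁻¹`. -/
lemma le_ridge_quadratic {Z : Matrix m ι ℝ} {ε : ℝ} (hε : 0 ≤ ε)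
    (h : IsUnit (Zᵀ * Z + ε • (1 : Matrix ι ι ℝ)).det) (u v : ι → ℝ) :
    2 * (u ⬝ᵥ v) - ((Z *ᵥ u) ⬝ᵥ (Z *ᵥ u) + ε * (u ⬝ᵥ u)) ≤ v ⬝ᵥ ridge Z ε *ᵥ v := by
  set g := ridge Z ε *ᵥ v with hg
  have h1 := dotProduct_ridge_mulVec h u v
  have h2 := dotProduct_ridge_mulVec h g v
  rw [← hg] at h1 h2
  have h3 : 0 ≤ (Z *ᵥ (g - u)) ⬝ᵥ (Z *ᵥ (g - u)) := real_dotProduct_self_nonneg _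
  have h4 : 0 ≤ ε * ((g - u) ⬝ᵥ (g - u)) := mul_nonneg hε (real_dotProduct_self_nonneg _)
  simp only [Matrix.mulVec_sub, sub_dotProduct, dotProduct_sub] at h3 h4
  rw [dotProduct_comm v g]
  have e1 := dotProduct_comm (Z *ᵥ g) (Z *ᵥ u)
  have e2 := dotProduct_comm g u
  rw [e1] at h3
  rw [e2] at h4
  linarith

/-- The squared column norms of `Z (ZᵀZ + ε)⁻¹` and of `(ZᵀZ + ε)⁻¹` add up to a diagonal entry
of `(ZᵀZ + ε)⁻¹`. This is the source of all bounds on the entries. -/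
lemma ridge_diag {Z : Matrix m ι ℝ} {ε : ℝ}
    (h : IsUnit (Zᵀ * Z + ε • (1 : Matrix ι ι ℝ)).det) (i : ι) :
    ridge Z ε i i = ∑ t, (Z * ridge Z ε) t i ^ 2 + ε * ∑ j, ridge Z ε j i ^ 2 := by
  have := dotProduct_ridge_mulVec h (ridge Z ε *ᵥ Pi.single i 1) (Pi.single i 1)
  rw [Matrix.mulVec_mulVec, dotProduct_self_eq_sum_sq, dotProduct_self_eq_sum_sq] at this
  simp only [Matrix.mulVec_single_one, dotProduct_single_one, Matrix.col_apply] at this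
  exact this.symm

lemma ridge_diag_nonneg {Z : Matrix m ι ℝ} {ε : ℝ} (hε : 0 ≤ ε)
    (h : IsUnit (Zᵀ * Z + ε • (1 : Matrix ι ι ℝ)).det) (i : ι) : 0 ≤ ridge Z ε i i := by
  rw [ridge_diag h]; positivity

lemma sq_mul_ridge_le {Z : Matrix m ι ℝ} {ε : ℝ} (hε : 0 ≤ ε)
    (h : IsUnit (Zᵀ * Z + ε • (1 : Matrix ι ι ℝ)).det) (t : m) (i : ι) :
    (Z * ridge Z ε) t i ^ 2 ≤ ridge Z ε i i := by
  rw [ridge_diag h]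
  have := Finset.single_le_sum (f := fun t => (Z * ridge Z ε) t i ^ 2)
    (fun _ _ => sq_nonneg _) (Finset.mem_univ t)
  have h2 : 0 ≤ ε * ∑ j, ridge Z ε j i ^ 2 := by positivity
  linarith

lemma eps_mul_sq_ridge_le {Z : Matrix m ι ℝ} {ε : ℝ} (hε : 0 ≤ ε)
    (h : IsUnit (Zᵀ * Z + ε • (1 : Matrix ι ι ℝ)).det) (i j : ι) :
    ε * ridge Z ε i j ^ 2 ≤ ridge Z ε j j := by
  rw [ridge_diag h j]
  have := Finset.single_le_sum (f := fun i => ridge Z ε i j ^ 2)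
    (fun _ _ => sq_nonneg _) (Finset.mem_univ i)
  have h2 : 0 ≤ ∑ t, (Z * ridge Z ε) t j ^ 2 := by positivity
  have := mul_le_mul_of_nonneg_left this hε
  linarith

lemma ridge_diag_le (Z : Matrix m ι ℝ) {ε : ℝ} (hε : 0 < ε) (i : ι) : ridge Z ε i i ≤ ε⁻¹ := by
  have h := isUnit_det_ridge Z hε
  have h1 := eps_mul_sq_ridge_le hε.le h i i
  have h0 := ridge_diag_nonneg hε.le h i
  rcases h0.eq_or_lt with h0 | h0
  · rw [← h0]; positivity
  · rw [le_inv_comm₀ h0 hε, ← one_div, le_div_iff₀ h0]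
    nlinarith

lemma abs_ridge_le (Z : Matrix m ι ℝ) {ε : ℝ} (hε : 0 < ε) (i j : ι) : |ridge Z ε i j| ≤ ε⁻¹ := by
  have h := isUnit_det_ridge Z hε
  have h1 := (eps_mul_sq_ridge_le hε.le h i j).trans (ridge_diag_le Z hε j)
  refine abs_le_of_sq_le_sq ?_ (by positivity)
  rw [← mul_le_mul_iff_right₀ hε]
  refine h1.trans (le_of_eq ?_)
  field_simp

/-- The leverage `zₜᵀ (ZᵀZ + ε)⁻¹ zₜ` of the row `t`. -/
noncomputable def leverage (Z : Matrix m ι ℝ) (ε : ℝ) (t : m) : ℝ := ∑ j, (Z * ridge Z ε) t j * Z t j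

lemma leverage_eq (Z : Matrix m ι ℝ) (ε : ℝ) (t : m) :
    leverage Z ε t = Z t ⬝ᵥ ridge Z ε *ᵥ Z t := by
  rw [leverage, Matrix.dotProduct_mulVec]
  rfl

lemma leverage_mem {Z : Matrix m ι ℝ} {ε : ℝ} (hε : 0 ≤ ε)
    (h : IsUnit (Zᵀ * Z + ε • (1 : Matrix ι ι ℝ)).det) (t : m) :
    0 ≤ leverage Z ε t ∧ leverage Z ε t ≤ 1 := by
  set u := ridge Z ε *ᵥ Z t with hu
  have h1 := dotProduct_ridge_mulVec h u (Z t)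
  rw [← hu, dotProduct_self_eq_sum_sq, dotProduct_self_eq_sum_sq, dotProduct_comm, hu,
    ← leverage_eq] at h1
  have h2 : 0 ≤ ε * ∑ j, u j ^ 2 := by positivity
  have h3 := Finset.single_le_sum (f := fun s => (Z *ᵥ u) s ^ 2)
    (fun _ _ => sq_nonneg _) (Finset.mem_univ t)
  have h4 : (Z *ᵥ u) t = leverage Z ε t := (leverage_eq Z ε t).symm
  have h5 : 0 ≤ ∑ s, (Z *ᵥ u) s ^ 2 := by positivity
  simp only [h4] at h3
  rw [← hu] at h1
  constructor
  · linarith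
  · nlinarith

lemma sum_leverage_add {Z : Matrix m ι ℝ} {ε : ℝ}
    (h : IsUnit (Zᵀ * Z + ε • (1 : Matrix ι ι ℝ)).det) :
    ∑ t, leverage Z ε t + ε * (ridge Z ε).trace = Fintype.card ι := by
  have h1 : ∑ t, leverage Z ε t = (Zᵀ * Z * ridge Z ε).trace := by
    rw [Matrix.mul_assoc, Matrix.trace_mul_comm]
    rfl
  have h2 : (Zᵀ * Z + ε • (1 : Matrix ι ι ℝ)) * ridge Z ε = 1 := Matrix.mul_nonsing_inv _ h
  have h3 := congrArg Matrix.trace h2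
  rw [Matrix.add_mul, Matrix.trace_add, ← h1, Matrix.smul_mul, Matrix.one_mul,
    Matrix.trace_smul, Matrix.trace_one, smul_eq_mul] at h3
  exact h3

lemma trace_ridge_nonneg {Z : Matrix m ι ℝ} {ε : ℝ} (hε : 0 ≤ ε)
    (h : IsUnit (Zᵀ * Z + ε • (1 : Matrix ι ι ℝ)).det) : 0 ≤ (ridge Z ε).trace :=
  Finset.sum_nonneg fun i _ => ridge_diag_nonneg hε h i

lemma ridge_diag_le_trace {Z : Matrix m ι ℝ} {ε : ℝ} (hε : 0 ≤ ε)
    (h : IsUnit (Zᵀ * Z + ε • (1 : Matrix ι ι ℝ)).det) (i : ι) :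
    ridge Z ε i i ≤ (ridge Z ε).trace :=
  Finset.single_le_sum (f := fun i => ridge Z ε i i) (fun i _ => ridge_diag_nonneg hε h i)
    (Finset.mem_univ i)

lemma trace_ridge_le (Z : Matrix m ι ℝ) {ε : ℝ} (hε : 0 < ε) :
    (ridge Z ε).trace ≤ Fintype.card ι * ε⁻¹ := by
  have := Finset.sum_le_card_nsmul Finset.univ (fun i => ridge Z ε i i) ε⁻¹
    (fun i _ => ridge_diag_le Z hε i)
  simpa [Matrix.trace] using this

/-- The regularised inverse is dominated by the inverse. -/
lemma ridge_diag_le_inv {Z : Matrix m ι ℝ} {ε : ℝ} (hε : 0 < ε) (h : IsUnit (Zᵀ * Z).det)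
    (i : ι) : ridge Z ε i i ≤ (Zᵀ * Z)⁻¹ i i := by
  have h0 : IsUnit (Zᵀ * Z + (0 : ℝ) • (1 : Matrix ι ι ℝ)).det := by simpa using h
  have hu := isUnit_det_ridge Z hε
  have h1 := le_ridge_quadratic le_rfl h0 (ridge Z ε *ᵥ Pi.single i 1) (Pi.single i 1)
  rw [ridge_zero, Matrix.mulVec_mulVec, dotProduct_self_eq_sum_sq] at h1
  simp only [Matrix.mulVec_single_one, dotProduct_single_one, Matrix.col_apply, zero_mul,
    add_zero, single_one_dotProduct] at h1
  have h2 := ridge_diag hu i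
  have h3 : 0 ≤ ε * ∑ j, ridge Z ε j i ^ 2 := by positivity
  linarith

/-- At a singular Gram matrix the trace of the regularised inverse explodes. -/
lemma inv_le_trace_ridge_of_singular {Z : Matrix m ι ℝ} {ε : ℝ} (hε : 0 < ε)
    (h : ¬ IsUnit (Zᵀ * Z).det) : ε⁻¹ ≤ (ridge Z ε).trace := by
  rw [isUnit_iff_ne_zero, not_not, ← Matrix.exists_mulVec_eq_zero_iff] at h
  obtain ⟨v, hv, hG⟩ := h
  have hZ : (Z *ᵥ v) ⬝ᵥ (Z *ᵥ v) = 0 := by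
    have := dotProduct_gram_mulVec Z 0 v v
    rw [zero_smul, add_zero, hG] at this
    simpa using this.symm
  have hN : 0 < v ⬝ᵥ v := lt_of_le_of_ne (real_dotProduct_self_nonneg v)
    (Ne.symm (by simpa [dotProduct_self_eq_zero] using hv))
  set N := v ⬝ᵥ v with hNdef
  have hi : ∀ i, v i ^ 2 / (ε * N) ≤ ridge Z ε i i := by
    intro i
    -- the optimal multiple of `v` in the variational characterisation
    have h1 := le_ridge_quadratic hε.le (isUnit_det_ridge Z hε) ((v i / (ε * N)) • v)
      (Pi.single i 1)
    simp only [Matrix.mulVec_smul, dotProduct_smul, smul_dotProduct, hZ, ← hNdef, smul_eq_mul,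
      Matrix.mulVec_single_one, dotProduct_single_one, Matrix.col_apply,
      single_one_dotProduct, Pi.smul_apply] at h1
    refine le_trans (le_of_eq ?_) h1
    field_simp
    ring
  have h2 : ∑ i, v i ^ 2 / (ε * N) ≤ (ridge Z ε).trace := Finset.sum_le_sum fun i _ => hi i
  rw [← Finset.sum_div, ← dotProduct_self_eq_sum_sq, ← hNdef] at h2
  refine le_trans (le_of_eq ?_) h2
  field_simp

lemma sum_mul_mul_ridge_ridge_nonneg (Z : Matrix m ι ℝ) (ε : ℝ) (t : m) :
    0 ≤ ∑ i, Z t i * (Z * ridge Z ε * ridge Z ε) t i := by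
  have : ∑ i, Z t i * (Z * ridge Z ε * ridge Z ε) t i = ∑ j, (Z * ridge Z ε) t j ^ 2 := by
    simp_rw [Matrix.mul_apply (M := Z * ridge Z ε), Finset.mul_sum]
    rw [Finset.sum_comm]
    refine Finset.sum_congr rfl fun j _ => ?_
    rw [sq]
    conv_rhs => arg 2; rw [Matrix.mul_apply]
    rw [Finset.mul_sum]
    refine Finset.sum_congr rfl fun i _ => ?_
    rw [ridge_symm]; ring
  rw [this]; positivity

lemma tendsto_ridge {Z : Matrix m ι ℝ} (h : IsUnit (Zᵀ * Z).det) :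
    Tendsto (fun ε => ridge Z ε) (𝓝 0) (𝓝 (Zᵀ * Z)⁻¹) := by
  have h1 : ContinuousAt Inv.inv (Zᵀ * Z) := by
    refine continuousAt_matrix_inv _ ?_
    rw [Ring.inverse_eq_inv']
    exact continuousAt_inv₀ h.ne_zero
  have h2 : Tendsto (fun ε : ℝ => Zᵀ * Z + ε • (1 : Matrix ι ι ℝ)) (𝓝 0) (𝓝 (Zᵀ * Z)) := by
    have : Continuous (fun ε : ℝ => Zᵀ * Z + ε • (1 : Matrix ι ι ℝ)) := by fun_prop
    simpa using this.tendsto 0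
  exact h1.tendsto.comp h2

/-- Derivative of the entries of the inverse of a matrix depending on a parameter. -/
lemma hasDerivAt_matrix_inv {B : ℝ → Matrix ι ι ℝ} {B' : Matrix ι ι ℝ} {s₀ : ℝ}
    (hB : ∀ i j, HasDerivAt (fun s => B s i j) (B' i j) s₀) (hu : IsUnit (B s₀).det) (i j : ι) :
    HasDerivAt (fun s => (B s)⁻¹ i j) (-((B s₀)⁻¹ * B' * (B s₀)⁻¹) i j) s₀ := by
  have hc : ContinuousAt B s₀ :=
    continuousAt_pi.2 fun i => continuousAt_pi.2 fun j => (hB i j).continuousAt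
  have hinv : Tendsto (fun s => (B s)⁻¹) (𝓝 s₀) (𝓝 (B s₀)⁻¹) := by
    have h1 : ContinuousAt Inv.inv (B s₀) := by
      refine continuousAt_matrix_inv _ ?_
      rw [Ring.inverse_eq_inv']
      exact continuousAt_inv₀ hu.ne_zero
    exact h1.tendsto.comp hc
  have hev : ∀ᶠ s in 𝓝 s₀, IsUnit (B s).det := by
    have h1 : Tendsto (fun s => (B s).det) (𝓝 s₀) (𝓝 (B s₀).det) :=
      (continuous_id.matrix_det.tendsto (B s₀)).comp hc
    exact (h1.eventually_ne hu.ne_zero).mono fun s hs => hs.isUnit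
  rw [hasDerivAt_iff_tendsto_slope]
  have hslope : Tendsto (fun s => (s - s₀)⁻¹ • (B s - B s₀)) (𝓝[≠] s₀) (𝓝 B') := by
    refine tendsto_pi_nhds.2 fun k => tendsto_pi_nhds.2 fun l => ?_
    have := hasDerivAt_iff_tendsto_slope.1 (hB k l)
    exact this.congr fun s => by simp [slope_def_field, div_eq_inv_mul]
  have hlim : Tendsto (fun s => -((B s)⁻¹ * ((s - s₀)⁻¹ • (B s - B s₀)) * (B s₀)⁻¹)) (𝓝[≠] s₀)
      (𝓝 (-((B s₀)⁻¹ * B' * (B s₀)⁻¹))) :=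
    (((hinv.mono_left nhdsWithin_le_nhds).mul hslope).mul tendsto_const_nhds).neg
  have hent : Tendsto (fun s => (-((B s)⁻¹ * ((s - s₀)⁻¹ • (B s - B s₀)) * (B s₀)⁻¹)) i j)
      (𝓝[≠] s₀) (𝓝 ((-((B s₀)⁻¹ * B' * (B s₀)⁻¹)) i j)) :=
    tendsto_pi_nhds.1 (tendsto_pi_nhds.1 hlim i) j
  refine hent.congr' ?_
  filter_upwards [hev.filter_mono nhdsWithin_le_nhds] with s hs
  have e : (B s)⁻¹ - (B s₀)⁻¹ = -((B s)⁻¹ * (B s - B s₀) * (B s₀)⁻¹) := by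
    rw [Matrix.mul_sub, Matrix.sub_mul, Matrix.nonsing_inv_mul _ hs, Matrix.mul_assoc,
      Matrix.mul_nonsing_inv _ hu]
    simp
  have e2 := congrFun (congrFun e i) j
  simp only [Matrix.sub_apply] at e2
  rw [slope_def_field, e2, Matrix.mul_smul, Matrix.smul_mul]
  simp only [Matrix.neg_apply, Matrix.smul_apply, smul_eq_mul]
  ring

end MatrixAlgebra

section Derivatives

variable {m ι : Type*}

/-! ### Derivatives in a single entry -/

/-- The matrix with the entries listed by `z`. -/
def toMat (z : m × ι → ℝ) : Matrix m ι ℝ := Matrix.of fun t i => z (t, i)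

@[simp] lemma toMat_apply (z : m × ι → ℝ) (t : m) (i : ι) : toMat z t i = z (t, i) := rfl

variable [DecidableEq m] [DecidableEq ι]

lemma hasDerivAt_toMat_update (z : m × ι → ℝ) (q : m × ι) (t : m) (i : ι) :
    HasDerivAt (fun s => toMat (Function.update z q s) t i) (Matrix.single q.1 q.2 1 t i) (z q) := by
  by_cases h : (t, i) = q
  · subst h
    simpa using! hasDerivAt_id' _
  · have : Matrix.single q.1 q.2 (1 : ℝ) t i = 0 := by
      rw [Matrix.single_apply, if_neg]
      rintro ⟨h1, h2⟩
      exact h (Prod.ext h1.symm h2.symm)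
    rw [this]
    simpa [Function.update_of_ne h] using hasDerivAt_const _ _

variable [Fintype m] [Fintype ι]

lemma hasDerivAt_ridge (z : m × ι → ℝ) {ε : ℝ} (hε : 0 < ε) (t : m) (i k l : ι) :
    HasDerivAt (fun s => ridge (toMat (Function.update z (t, i) s)) ε k l)
      (-(ridge (toMat z) ε k i * (toMat z * ridge (toMat z) ε) t l +
        (toMat z * ridge (toMat z) ε) t k * ridge (toMat z) ε i l)) (z (t, i)) := by
  set E : Matrix m ι ℝ := Matrix.single t i 1 with hE
  have hB : ∀ a b, HasDerivAt (fun s => ((toMat (Function.update z (t, i) s))ᵀ *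
      toMat (Function.update z (t, i) s) + ε • (1 : Matrix ι ι ℝ)) a b)
      ((Eᵀ * toMat z + (toMat z)ᵀ * E) a b) (z (t, i)) := by
    intro a b
    simp only [Matrix.add_apply, Matrix.mul_apply, Matrix.transpose_apply]
    refine HasDerivAt.add_const _ ?_
    rw [← Finset.sum_add_distrib]
    refine HasDerivAt.fun_sum fun r _ => ?_
    have := (hasDerivAt_toMat_update z (t, i) r a).fun_mul (hasDerivAt_toMat_update z (t, i) r b)
    simpa using this
  have h := hasDerivAt_matrix_inv hB (by simpa using isUnit_det_ridge (toMat z) hε) k l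
  simp only [Function.update_eq_self] at h
  refine h.congr_deriv ?_
  change -(ridge (toMat z) ε * (Eᵀ * toMat z + (toMat z)ᵀ * E) * ridge (toMat z) ε) k l = _
  congr 1
  have e1 : ridge (toMat z) ε * (Eᵀ * toMat z + (toMat z)ᵀ * E) * ridge (toMat z) ε =
      ridge (toMat z) ε * Eᵀ * (toMat z * ridge (toMat z) ε) +
        (toMat z * ridge (toMat z) ε)ᵀ * E * ridge (toMat z) ε := by
    rw [Matrix.transpose_mul, ridge_transpose]
    simp only [Matrix.mul_add, Matrix.add_mul, Matrix.mul_assoc]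
  rw [e1, Matrix.add_apply]
  congr 1
  · rw [hE, Matrix.transpose_single, Matrix.mul_apply, Finset.sum_eq_single t]
    · simp
    · intro b _ hb
      simp [hb]
    · simp
  · rw [hE, Matrix.mul_apply, Finset.sum_eq_single i]
    · simp [-Matrix.transpose_mul]
    · intro b _ hb
      simp [hb]
    · simp

lemma hasDerivAt_mul_ridge (z : m × ι → ℝ) {ε : ℝ} (hε : 0 < ε) (t : m) (i : ι) :
    HasDerivAt (fun s => (toMat (Function.update z (t, i) s) *
        ridge (toMat (Function.update z (t, i) s)) ε) t i)
      (ridge (toMat z) ε i i - (toMat z * ridge (toMat z) ε) t i ^ 2 -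
        leverage (toMat z) ε t * ridge (toMat z) ε i i) (z (t, i)) := by
  simp only [Matrix.mul_apply]
  have h : ∀ j ∈ Finset.univ, HasDerivAt (fun s => toMat (Function.update z (t, i) s) t j *
      ridge (toMat (Function.update z (t, i) s)) ε j i) _ (z (t, i)) := fun j _ =>
    (hasDerivAt_toMat_update z (t, i) t j).fun_mul (hasDerivAt_ridge z hε t i j i)
  refine (HasDerivAt.fun_sum h).congr_deriv ?_
  simp only [Function.update_eq_self, Finset.sum_add_distrib, mul_neg, mul_add,
    Finset.sum_neg_distrib]
  have e1 : ∑ j, Matrix.single t i (1 : ℝ) t j * ridge (toMat z) ε j i = ridge (toMat z) ε i i := by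
    rw [Finset.sum_eq_single i]
    · simp
    · intro b _ hb
      simp [hb.symm]
    · simp
  have e2 : ∑ j, toMat z t j * (ridge (toMat z) ε j i * (toMat z * ridge (toMat z) ε) t i) =
      (toMat z * ridge (toMat z) ε) t i ^ 2 := by
    rw [sq]
    conv_rhs => arg 1; rw [Matrix.mul_apply]
    rw [Finset.sum_mul]
    exact Finset.sum_congr rfl fun _ _ => by ring
  have e3 : ∑ j, toMat z t j * ((toMat z * ridge (toMat z) ε) t j * ridge (toMat z) ε i i) =
      leverage (toMat z) ε t * ridge (toMat z) ε i i := by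
    rw [leverage, Finset.sum_mul]
    exact Finset.sum_congr rfl fun _ _ => by ring
  rw [e1, e2, e3, sq, Matrix.mul_apply]
  ring

lemma hasDerivAt_mul_trace_ridge (z : m × ι → ℝ) {ε : ℝ} (hε : 0 < ε) (t : m) (i : ι) :
    HasDerivAt (fun s => Function.update z (t, i) s (t, i) *
        (ridge (toMat (Function.update z (t, i) s)) ε).trace)
      ((ridge (toMat z) ε).trace -
        2 * (z (t, i) * (toMat z * ridge (toMat z) ε * ridge (toMat z) ε) t i)) (z (t, i)) := by
  simp only [Matrix.trace, Matrix.diag_apply, Function.update_self]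
  refine ((hasDerivAt_id' (z (t, i))).fun_mul
    (HasDerivAt.fun_sum fun k _ => hasDerivAt_ridge z hε t i k k)).congr_deriv ?_
  have e : ∑ k, -(ridge (toMat z) ε k i * (toMat z * ridge (toMat z) ε) t k +
        (toMat z * ridge (toMat z) ε) t k * ridge (toMat z) ε i k) =
      -(2 * (toMat z * ridge (toMat z) ε * ridge (toMat z) ε) t i) := by
    rw [Matrix.mul_apply, Finset.mul_sum, ← Finset.sum_neg_distrib]
    refine Finset.sum_congr rfl fun k _ => ?_
    rw [ridge_symm _ _ i k]
    ring
  rw [e]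
  simp
  ring

end Derivatives

/-! ### Moments of the inverse Gram matrix of a Gaussian matrix -/

section Fatou

variable {α : Type*} [MeasurableSpace α] {ν : Measure α}

lemma lintegral_liminf_le_of_integral_le {f : ℕ → α → ℝ} {C : ℝ}
    (hf : ∀ k, Integrable (f k) ν) (h0 : ∀ k x, 0 ≤ f k x) (hC : ∀ k, ∫ x, f k x ∂ν ≤ C) :
    ∫⁻ x, liminf (fun k => ENNReal.ofReal (f k x)) atTop ∂ν ≤ ENNReal.ofReal C := by
  refine (lintegral_liminf_le' fun k => (hf k).1.aemeasurable.ennreal_ofReal).trans ?_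
  refine (liminf_le_liminf (v := fun _ => ENNReal.ofReal C) (Eventually.of_forall fun k => ?_)).trans
    (by simp)
  rw [← ofReal_integral_eq_lintegral_ofReal (hf k) (ae_of_all _ (h0 k))]
  exact ENNReal.ofReal_le_ofReal (hC k)

/-- Fatou: an almost everywhere limit of nonnegative functions with bounded integrals is
integrable. -/
lemma integrable_of_tendsto_of_integral_le {f : ℕ → α → ℝ} {g : α → ℝ} {C : ℝ}
    (hf : ∀ k, Integrable (f k) ν) (h0 : ∀ k x, 0 ≤ f k x) (hC : ∀ k, ∫ x, f k x ∂ν ≤ C)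
    (hg : ∀ᵐ x ∂ν, Tendsto (fun k => f k x) atTop (𝓝 (g x))) : Integrable g ν := by
  have hm : AEStronglyMeasurable g ν := aestronglyMeasurable_of_tendsto_ae atTop (fun k => (hf k).1) hg
  have hg0 : 0 ≤ᵐ[ν] g := hg.mono fun x hx => ge_of_tendsto' hx fun k => h0 k x
  refine ⟨hm, ?_⟩
  rw [hasFiniteIntegral_iff_ofReal hg0]
  refine lt_of_le_of_lt ?_ (ENNReal.ofReal_lt_top (r := C))
  refine le_trans (lintegral_mono_ae ?_) (lintegral_liminf_le_of_integral_le hf h0 hC)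
  filter_upwards [hg] with x hx
  rw [((ENNReal.continuous_ofReal.tendsto _).comp hx).liminf_eq.symm]
  rfl

end Fatou

section Measurability

variable {α m ι : Type*} [MeasurableSpace α] [Fintype m] [Fintype ι] [DecidableEq ι]

lemma measurable_matrix_inv {B : α → Matrix ι ι ℝ} (hB : ∀ i j, Measurable fun x => B x i j)
    (i j : ι) : Measurable fun x => (B x)⁻¹ i j := by
  have hB' : Measurable fun x i j => B x i j :=
    measurable_pi_lambda _ fun i => measurable_pi_lambda _ fun j => hB i j
  have h1 : Continuous fun M : ι → ι → ℝ => (Matrix.of M).det :=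
    Continuous.matrix_det continuous_id
  have h2 : Continuous fun M : ι → ι → ℝ => (Matrix.of M).adjugate i j :=
    (Continuous.matrix_adjugate continuous_id).matrix_elem i j
  have : (fun x => (B x)⁻¹ i j) = fun x => ((fun M : ι → ι → ℝ => (Matrix.of M).det)
      (fun i j => B x i j))⁻¹ * (fun M : ι → ι → ℝ => (Matrix.of M).adjugate i j)
      (fun i j => B x i j) := by
    ext x
    rw [Matrix.inv_def, Ring.inverse_eq_inv']
    rfl
  rw [this]
  exact (h1.measurable.comp hB').inv.mul (h2.measurable.comp hB')

lemma measurable_ridge (ε : ℝ) (i j : ι) :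
    Measurable fun z : m × ι → ℝ => ridge (toMat z) ε i j := by
  refine measurable_matrix_inv (fun i j => ?_) i j
  simp only [Matrix.add_apply, Matrix.mul_apply, Matrix.transpose_apply, toMat_apply]
  fun_prop

lemma measurable_mul_ridge (ε : ℝ) (t : m) (i : ι) :
    Measurable fun z : m × ι → ℝ => (toMat z * ridge (toMat z) ε) t i := by
  simp only [Matrix.mul_apply, toMat_apply]
  have := measurable_ridge (m := m) (ι := ι) ε
  fun_prop

lemma measurable_leverage (ε : ℝ) (t : m) :
    Measurable fun z : m × ι → ℝ => leverage (toMat z) ε t := by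
  unfold leverage
  exact Finset.measurable_sum _ fun j _ =>
    (measurable_mul_ridge ε t j).mul (measurable_pi_apply (t, j))

lemma measurable_trace_ridge (ε : ℝ) :
    Measurable fun z : m × ι → ℝ => (ridge (toMat z) ε).trace := by
  simp only [Matrix.trace, Matrix.diag_apply]
  have := measurable_ridge (m := m) (ι := ι) ε
  fun_prop

end Measurability

section Moments

variable (m ι : Type*) [Fintype m] [Fintype ι]

/-- The law of the entries of a matrix with independent standard Gaussian entries. -/
noncomputable def gaussianEntries : Measure (m × ι → ℝ) := Measure.pi fun _ => gaussianReal 0 1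

instance : IsProbabilityMeasure (gaussianEntries m ι) := by
  unfold gaussianEntries; infer_instance

variable {m ι}

lemma memLp_entry (q : m × ι) : MemLp (fun z : m × ι → ℝ => z q) 2 (gaussianEntries m ι) := by
  classical
  have h : MemLp id 2 (gaussianReal 0 1) := IsGaussian.memLp_two_id
  exact h.comp_measurePreserving (measurePreserving_eval (fun _ : m × ι => gaussianReal 0 1) q)

lemma card_gap_pos (hc : Fintype.card ι + 1 < Fintype.card m) : (0 : ℝ) < Fintype.card m - Fintype.card ι - 1 := by
  have : (Fintype.card ι : ℝ) + 1 < Fintype.card m := by exact_mod_cast hc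
  linarith

variable [DecidableEq ι]

lemma integrable_ridge {ε : ℝ} (hε : 0 < ε) (i j : ι) :
    Integrable (fun z => ridge (toMat z) ε i j) (gaussianEntries m ι) :=
  Integrable.of_bound (measurable_ridge ε i j).aestronglyMeasurable ε⁻¹
    (ae_of_all _ fun z => abs_ridge_le (toMat z) hε i j)

lemma integrable_trace_ridge {ε : ℝ} (hε : 0 < ε) :
    Integrable (fun z => (ridge (toMat z) ε).trace) (gaussianEntries m ι) :=
  integrable_finsetSum _ fun i _ => integrable_ridge hε i i

lemma abs_mul_ridge_le (Z : Matrix m ι ℝ) {ε : ℝ} (hε : 0 < ε) (t : m) (i : ι) :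
    |(Z * ridge Z ε) t i| ≤ 1 + ε⁻¹ := by
  have h := (sq_mul_ridge_le hε.le (isUnit_det_ridge Z hε) t i).trans (ridge_diag_le Z hε i)
  have : |(Z * ridge Z ε) t i| ^ 2 ≤ ε⁻¹ := by rwa [sq_abs]
  nlinarith [sq_nonneg (|(Z * ridge Z ε) t i| - 1), abs_nonneg ((Z * ridge Z ε) t i)]

lemma integrable_mul_ridge {ε : ℝ} (hε : 0 < ε) (t : m) (i : ι) :
    Integrable (fun z => (toMat z * ridge (toMat z) ε) t i) (gaussianEntries m ι) :=
  Integrable.of_bound (measurable_mul_ridge ε t i).aestronglyMeasurable (1 + ε⁻¹)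
    (ae_of_all _ fun z => abs_mul_ridge_le (toMat z) hε t i)

lemma integrable_mul_ridge_sq {ε : ℝ} (hε : 0 < ε) (t : m) (i : ι) :
    Integrable (fun z => (toMat z * ridge (toMat z) ε) t i ^ 2) (gaussianEntries m ι) := by
  refine Integrable.of_bound ((measurable_mul_ridge ε t i).pow_const 2).aestronglyMeasurable ε⁻¹
    (ae_of_all _ fun z => ?_)
  rw [Real.norm_of_nonneg (sq_nonneg _)]
  exact (sq_mul_ridge_le hε.le (isUnit_det_ridge _ hε) t i).trans (ridge_diag_le _ hε i)

lemma integrable_leverage {ε : ℝ} (hε : 0 < ε) (t : m) :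
    Integrable (fun z => leverage (toMat z) ε t) (gaussianEntries m ι) := by
  refine Integrable.of_bound (measurable_leverage ε t).aestronglyMeasurable 1
    (ae_of_all _ fun z => ?_)
  obtain ⟨h0, h1⟩ := leverage_mem hε.le (isUnit_det_ridge (toMat z) hε) t
  rwa [Real.norm_of_nonneg h0]

lemma integrable_leverage_mul_ridge {ε : ℝ} (hε : 0 < ε) (t : m) (i : ι) :
    Integrable (fun z => leverage (toMat z) ε t * ridge (toMat z) ε i i)
      (gaussianEntries m ι) := by
  refine (integrable_ridge hε i i).mono
    ((measurable_leverage ε t).mul (measurable_ridge ε i i)).aestronglyMeasurable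
    (ae_of_all _ fun z => ?_)
  obtain ⟨h0, h1⟩ := leverage_mem hε.le (isUnit_det_ridge (toMat z) hε) t
  rw [norm_mul, Real.norm_of_nonneg h0]
  exact mul_le_of_le_one_left (norm_nonneg _) h1

lemma integrable_entry_mul_mul_ridge {ε : ℝ} (hε : 0 < ε) (t : m) (i : ι) :
    Integrable (fun z => z (t, i) * (toMat z * ridge (toMat z) ε) t i) (gaussianEntries m ι) :=
  ((memLp_entry (t, i)).integrable one_le_two).mul_bdd (c := 1 + ε⁻¹)
    (measurable_mul_ridge ε t i).aestronglyMeasurable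
    (ae_of_all _ fun z => abs_mul_ridge_le (toMat z) hε t i)

lemma norm_trace_ridge_le (Z : Matrix m ι ℝ) {ε : ℝ} (hε : 0 < ε) :
    ‖(ridge Z ε).trace‖ ≤ Fintype.card ι * ε⁻¹ := by
  rw [Real.norm_of_nonneg (trace_ridge_nonneg hε.le (isUnit_det_ridge Z hε))]
  exact trace_ridge_le Z hε

lemma integrable_entry_mul_trace_ridge {ε : ℝ} (hε : 0 < ε) (q : m × ι) :
    Integrable (fun z => z q * (ridge (toMat z) ε).trace) (gaussianEntries m ι) :=
  ((memLp_entry q).integrable one_le_two).mul_bdd (measurable_trace_ridge ε).aestronglyMeasurable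
    (ae_of_all _ fun z => norm_trace_ridge_le (toMat z) hε)

lemma integrable_entry_sq_mul_trace_ridge {ε : ℝ} (hε : 0 < ε) (q : m × ι) :
    Integrable (fun z => z q * (z q * (ridge (toMat z) ε).trace)) (gaussianEntries m ι) := by
  have := (memLp_entry q).integrable_sq.mul_bdd (measurable_trace_ridge ε).aestronglyMeasurable
    (ae_of_all _ fun z => norm_trace_ridge_le (toMat z) hε)
  exact this.congr (ae_of_all _ fun z => by simp only; ring)

lemma integrable_entry_mul_mul_ridge_ridge {ε : ℝ} (hε : 0 < ε) (t : m) (i : ι) :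
    Integrable (fun z => z (t, i) * (toMat z * ridge (toMat z) ε * ridge (toMat z) ε) t i)
      (gaussianEntries m ι) := by
  have h1 := measurable_ridge (m := m) (ι := ι) ε
  have h2 := measurable_mul_ridge (m := m) (ι := ι) ε
  refine ((memLp_entry (t, i)).integrable one_le_two).mul_bdd
    (c := ∑ _k : ι, (1 + ε⁻¹) * ε⁻¹) ?_ (ae_of_all _ fun z => ?_)
  · simp only [Matrix.mul_apply (M := _ * _)]
    exact (Finset.measurable_sum _ fun k _ => (h2 t k).mul (h1 k i)).aestronglyMeasurable
  · rw [Matrix.mul_apply]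
    refine norm_sum_le_of_le _ fun k _ => ?_
    rw [norm_mul]
    exact mul_le_mul (abs_mul_ridge_le _ hε t k) (abs_ridge_le _ hε k i) (norm_nonneg _)
      (by positivity)

lemma sum_stein_terms (Z : Matrix m ι ℝ) (ε : ℝ) :
    ∑ t, ∑ i, (ridge Z ε i i - (Z * ridge Z ε) t i ^ 2 - leverage Z ε t * ridge Z ε i i
      - Z t i * (Z * ridge Z ε) t i) =
    (Fintype.card m : ℝ) * (ridge Z ε).trace - ∑ t, ∑ i, (Z * ridge Z ε) t i ^ 2
        - (∑ t, leverage Z ε t) * (ridge Z ε).trace - ∑ t, leverage Z ε t := by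
  have e : ∀ t, ∑ i, Z t i * (Z * ridge Z ε) t i = leverage Z ε t :=
    fun t => Finset.sum_congr rfl fun i _ => mul_comm _ _
  simp only [Finset.sum_sub_distrib, ← Finset.mul_sum, e, Finset.sum_const, Finset.card_univ,
    nsmul_eq_mul, ← Finset.sum_mul]
  rfl

/-- Stein's identity for the entries of `Z (ZᵀZ + ε)⁻¹`, summed over all entries. -/
lemma integral_sum_leverage {ε : ℝ} (hε : 0 < ε) :
    ∫ z, ((Fintype.card m : ℝ) * (ridge (toMat z) ε).trace
        - ∑ t, ∑ i, (toMat z * ridge (toMat z) ε) t i ^ 2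
        - (∑ t, leverage (toMat z) ε t) * (ridge (toMat z) ε).trace
        - ∑ t, leverage (toMat z) ε t) ∂gaussianEntries m ι = 0 := by
  classical
  have hI : ∀ t i, Integrable (fun z => ridge (toMat z) ε i i
      - (toMat z * ridge (toMat z) ε) t i ^ 2 - leverage (toMat z) ε t * ridge (toMat z) ε i i)
      (gaussianEntries m ι) := fun t i =>
    ((integrable_ridge hε i i).sub (integrable_mul_ridge_sq hε t i)).sub
      (integrable_leverage_mul_ridge hε t i)
  have hJ := integrable_entry_mul_mul_ridge (m := m) (ι := ι) hε
  have key : ∀ t i, ∫ z, (ridge (toMat z) ε i i - (toMat z * ridge (toMat z) ε) t i ^ 2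
      - leverage (toMat z) ε t * ridge (toMat z) ε i i
      - z (t, i) * (toMat z * ridge (toMat z) ε) t i) ∂gaussianEntries m ι = 0 := by
    intro t i
    rw [integral_sub (hI t i) (hJ t i), sub_eq_zero]
    exact (integral_mul_pi_gaussianReal (t, i) (fun z => hasDerivAt_mul_ridge z hε t i)
      (integrable_mul_ridge hε t i) (hI t i) (hJ t i)).symm
  have hK : ∀ t i, Integrable (fun z => ridge (toMat z) ε i i
      - (toMat z * ridge (toMat z) ε) t i ^ 2 - leverage (toMat z) ε t * ridge (toMat z) ε i i
      - z (t, i) * (toMat z * ridge (toMat z) ε) t i) (gaussianEntries m ι) :=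
    fun t i => (hI t i).sub (hJ t i)
  have hsum : ∫ z, (∑ t : m, ∑ i : ι, (ridge (toMat z) ε i i
      - (toMat z * ridge (toMat z) ε) t i ^ 2
      - leverage (toMat z) ε t * ridge (toMat z) ε i i
      - z (t, i) * (toMat z * ridge (toMat z) ε) t i)) ∂gaussianEntries m ι = 0 := by
    rw [integral_finsetSum _
      (fun t _ => integrable_finsetSum _ fun i _ => hK t i)]
    refine Finset.sum_eq_zero fun t _ => ?_
    rw [integral_finsetSum _ (fun i _ => hK t i)]
    exact Finset.sum_eq_zero fun i _ => key t i
  rw [← hsum]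
  exact integral_congr_ae (ae_of_all _ fun z => (sum_stein_terms (toMat z) ε).symm)

lemma sum_sq_mul_ridge_add {Z : Matrix m ι ℝ} {ε : ℝ}
    (h : IsUnit (Zᵀ * Z + ε • (1 : Matrix ι ι ℝ)).det) :
    ∑ t, ∑ i, (Z * ridge Z ε) t i ^ 2 + ε * ∑ i, ∑ j, ridge Z ε j i ^ 2 = (ridge Z ε).trace := by
  rw [Finset.sum_comm, Finset.mul_sum, ← Finset.sum_add_distrib]
  exact Finset.sum_congr rfl fun i _ => (ridge_diag h i).symm

lemma sum_sq_mul_ridge_le {Z : Matrix m ι ℝ} {ε : ℝ} (hε : 0 ≤ ε)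
    (h : IsUnit (Zᵀ * Z + ε • (1 : Matrix ι ι ℝ)).det) :
    ∑ t, ∑ i, (Z * ridge Z ε) t i ^ 2 ≤ (ridge Z ε).trace := by
  rw [← sum_sq_mul_ridge_add h]
  exact le_add_of_nonneg_right (by positivity)

lemma sum_leverage_le {Z : Matrix m ι ℝ} {ε : ℝ} (hε : 0 ≤ ε)
    (h : IsUnit (Zᵀ * Z + ε • (1 : Matrix ι ι ℝ)).det) :
    ∑ t, leverage Z ε t ≤ Fintype.card ι := by
  have := sum_leverage_add h
  nlinarith [mul_nonneg hε (trace_ridge_nonneg hε h)]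

lemma sum_leverage_nonneg {Z : Matrix m ι ℝ} {ε : ℝ} (hε : 0 ≤ ε)
    (h : IsUnit (Zᵀ * Z + ε • (1 : Matrix ι ι ℝ)).det) :
    0 ≤ ∑ t, leverage Z ε t :=
  Finset.sum_nonneg fun t _ => (leverage_mem hε h t).1

lemma integrable_stein_sum {ε : ℝ} (hε : 0 < ε) :
    Integrable (fun z => (Fintype.card m : ℝ) * (ridge (toMat z) ε).trace
        - ∑ t, ∑ i, (toMat z * ridge (toMat z) ε) t i ^ 2
        - (∑ t, leverage (toMat z) ε t) * (ridge (toMat z) ε).trace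
        - ∑ t, leverage (toMat z) ε t) (gaussianEntries m ι) := by
  refine ((((integrable_trace_ridge hε).const_mul _).sub (integrable_finsetSum _ fun t _ =>
    integrable_finsetSum _ fun i _ => integrable_mul_ridge_sq hε t i)).sub ?_).sub
    (integrable_finsetSum _ fun t _ => integrable_leverage hε t)
  have : (fun z : m × ι → ℝ => (∑ t, leverage (toMat z) ε t) * (ridge (toMat z) ε).trace) =
      fun z => ∑ t, ∑ i, leverage (toMat z) ε t * ridge (toMat z) ε i i := by
    ext z
    simp only [← Finset.mul_sum, ← Finset.sum_mul]
    rfl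
  rw [this]
  exact integrable_finsetSum _ fun t _ => integrable_finsetSum _ fun i _ =>
    integrable_leverage_mul_ridge hε t i

variable (hc : Fintype.card ι + 1 < Fintype.card m)
include hc

lemma integral_trace_ridge_le {ε : ℝ} (hε : 0 < ε) :
    ∫ z, (ridge (toMat z) ε).trace ∂gaussianEntries m ι ≤
      (Fintype.card ι : ℝ) / (Fintype.card m - Fintype.card ι - 1) := by
  have hg := card_gap_pos hc
  have h1 : ∫ z, (((Fintype.card m : ℝ) - Fintype.card ι - 1) * (ridge (toMat z) ε).trace
      - Fintype.card ι) ∂gaussianEntries m ι ≤ 0 := by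
    rw [← integral_sum_leverage (m := m) (ι := ι) hε]
    refine integral_mono (((integrable_trace_ridge hε).const_mul _).sub (integrable_const _))
      (integrable_stein_sum hε) fun z => ?_
    have hu := isUnit_det_ridge (toMat z) hε
    have h1 := sum_sq_mul_ridge_le hε.le hu
    have h2 := sum_leverage_le hε.le hu
    have h3 := trace_ridge_nonneg hε.le hu
    have h4 := mul_le_mul_of_nonneg_right h2 h3
    simp only
    linarith
  rw [integral_sub ((integrable_trace_ridge hε).const_mul _) (integrable_const _),
    integral_const_mul] at h1
  simp only [integral_const, probReal_univ, smul_eq_mul, one_mul] at h1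
  rw [le_div_iff₀ hg]
  linarith

/-- The Gram matrix of a Gaussian matrix is almost surely invertible: where it is singular the
traces of the regularised inverses explode, while their means stay bounded. -/
lemma ae_isUnit_gram : ∀ᵐ z ∂gaussianEntries m ι, IsUnit ((toMat z)ᵀ * toMat z).det := by
  have hF := lintegral_liminf_le_of_integral_le
    (fun k : ℕ => integrable_trace_ridge (m := m) (ι := ι) (ε := 1 / ((k : ℝ) + 1)) (by positivity))
    (fun k z => trace_ridge_nonneg (by positivity) (isUnit_det_ridge _ (by positivity)))
    (fun k => integral_trace_ridge_le hc (by positivity))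
  have hm : Measurable fun z : m × ι → ℝ =>
      liminf (fun k : ℕ => ENNReal.ofReal (ridge (toMat z) (1 / ((k : ℝ) + 1))).trace) atTop :=
    Measurable.liminf fun k => (measurable_trace_ridge _).ennreal_ofReal
  filter_upwards [ae_lt_top hm (hF.trans_lt ENNReal.ofReal_lt_top).ne] with z hz
  by_contra hs
  refine hz.ne (Tendsto.liminf_eq ?_)
  refine ENNReal.tendsto_ofReal_atTop.comp ?_
  refine tendsto_atTop_mono (fun k => ?_) (tendsto_natCast_atTop_atTop (R := ℝ))
  refine le_trans ?_ (inv_le_trace_ridge_of_singular (by positivity) hs)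
  simp

lemma ae_tendsto_trace_ridge : ∀ᵐ z ∂gaussianEntries m ι,
    Tendsto (fun k : ℕ => (ridge (toMat z) (1 / ((k : ℝ) + 1))).trace) atTop
      (𝓝 ((toMat z)ᵀ * toMat z)⁻¹.trace) := by
  filter_upwards [ae_isUnit_gram hc] with z hz
  exact ((continuous_id.matrix_trace.tendsto _).comp (tendsto_ridge hz)).comp
    tendsto_one_div_add_atTop_nhds_zero_nat

lemma integrable_trace_inv_gram :
    Integrable (fun z => ((toMat z)ᵀ * toMat z)⁻¹.trace) (gaussianEntries m ι) :=
  integrable_of_tendsto_of_integral_le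
    (fun k : ℕ => integrable_trace_ridge (m := m) (ι := ι) (ε := 1 / ((k : ℝ) + 1)) (by positivity))
    (fun k z => trace_ridge_nonneg (by positivity) (isUnit_det_ridge _ (by positivity)))
    (fun k => integral_trace_ridge_le hc (by positivity)) (ae_tendsto_trace_ridge hc)

/-- The mean of the trace of the inverse Wishart distribution, from the limit `ε → 0` of Stein's
identity, in which `∑ₜ leverageₜ → card ι`. -/
lemma integral_trace_inv_gram :
    ∫ z, ((toMat z)ᵀ * toMat z)⁻¹.trace ∂gaussianEntries m ι =
      (Fintype.card ι : ℝ) / (Fintype.card m - Fintype.card ι - 1) := by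
  have hg := card_gap_pos hc
  have hint := integrable_trace_inv_gram hc
  have hlim := tendsto_integral_of_dominated_convergence
    (μ := gaussianEntries m ι)
    (F := fun (k : ℕ) z => (Fintype.card m : ℝ) * (ridge (toMat z) (1 / ((k : ℝ) + 1))).trace
        - ∑ t, ∑ i, (toMat z * ridge (toMat z) (1 / ((k : ℝ) + 1))) t i ^ 2
        - (∑ t, leverage (toMat z) (1 / ((k : ℝ) + 1)) t) *
          (ridge (toMat z) (1 / ((k : ℝ) + 1))).trace
        - ∑ t, leverage (toMat z) (1 / ((k : ℝ) + 1)) t)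
    (f := fun z => ((Fintype.card m : ℝ) - Fintype.card ι - 1) * ((toMat z)ᵀ * toMat z)⁻¹.trace
      - Fintype.card ι)
    (fun z => ((Fintype.card m : ℝ) + 1 + Fintype.card ι) * ((toMat z)ᵀ * toMat z)⁻¹.trace
      + Fintype.card ι)
    (fun k => (integrable_stein_sum (by positivity)).1)
    ((hint.const_mul _).add (integrable_const _)) ?_ ?_
  · simp only [integral_sum_leverage (Nat.one_div_pos_of_nat (α := ℝ))] at hlim
    have h0 := tendsto_nhds_unique hlim tendsto_const_nhds
    rw [integral_sub (hint.const_mul _) (integrable_const _), integral_const_mul] at h0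
    simp only [integral_const, probReal_univ, smul_eq_mul, one_mul] at h0
    rw [eq_div_iff hg.ne']
    linarith
  · intro k
    filter_upwards [ae_isUnit_gram hc] with z hz
    have hε : (0 : ℝ) < 1 / ((k : ℝ) + 1) := by positivity
    generalize 1 / ((k : ℝ) + 1) = ε at hε
    have hu := isUnit_det_ridge (toMat z) hε
    have h1 := sum_sq_mul_ridge_le hε.le hu
    have h1' : 0 ≤ ∑ t, ∑ i, (toMat z * ridge (toMat z) ε) t i ^ 2 := by positivity
    have h2 := sum_leverage_le hε.le hu
    have h2' := sum_leverage_nonneg hε.le hu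
    have h3 := trace_ridge_nonneg hε.le hu
    have h4 := mul_le_mul_of_nonneg_right h2 h3
    have h4' := mul_nonneg h2' h3
    have h5 : (ridge (toMat z) ε).trace ≤ ((toMat z)ᵀ * toMat z)⁻¹.trace :=
      Finset.sum_le_sum fun i _ => ridge_diag_le_inv hε hz i
    have h6 := mul_le_mul_of_nonneg_left h5 (Nat.cast_nonneg (α := ℝ) (Fintype.card m))
    have h7 := mul_le_mul_of_nonneg_left h5 (Nat.cast_nonneg (α := ℝ) (Fintype.card ι))
    have h8 := mul_nonneg (Nat.cast_nonneg (α := ℝ) (Fintype.card m)) h3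
    rw [Real.norm_eq_abs, abs_le]
    constructor <;> linarith
  · filter_upwards [ae_isUnit_gram hc, ae_tendsto_trace_ridge hc] with z hz ht
    have hε : Tendsto (fun k : ℕ => 1 / ((k : ℝ) + 1)) atTop (𝓝 0) :=
      tendsto_one_div_add_atTop_nhds_zero_nat
    have hH := (tendsto_ridge hz).comp hε
    have hL : Tendsto (fun k : ℕ => ∑ t, leverage (toMat z) (1 / ((k : ℝ) + 1)) t) atTop
        (𝓝 (Fintype.card ι : ℝ)) := by
      have : Tendsto (fun k : ℕ => (Fintype.card ι : ℝ) - 1 / ((k : ℝ) + 1) *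
          (ridge (toMat z) (1 / ((k : ℝ) + 1))).trace) atTop
          (𝓝 (Fintype.card ι - 0 * ((toMat z)ᵀ * toMat z)⁻¹.trace)) :=
        tendsto_const_nhds.sub (hε.mul ht)
      rw [zero_mul, sub_zero] at this
      refine this.congr fun k => ?_
      rw [← sum_leverage_add (isUnit_det_ridge (toMat z) Nat.one_div_pos_of_nat)]
      ring
    have hQ : Tendsto (fun k : ℕ =>
        ∑ t, ∑ i, (toMat z * ridge (toMat z) (1 / ((k : ℝ) + 1))) t i ^ 2) atTop
        (𝓝 ((toMat z)ᵀ * toMat z)⁻¹.trace) := by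
      have : Tendsto (fun k : ℕ => (ridge (toMat z) (1 / ((k : ℝ) + 1))).trace -
          1 / ((k : ℝ) + 1) * ∑ i, ∑ j, ridge (toMat z) (1 / ((k : ℝ) + 1)) j i ^ 2) atTop
          (𝓝 (((toMat z)ᵀ * toMat z)⁻¹.trace -
            0 * ∑ i, ∑ j, ((toMat z)ᵀ * toMat z)⁻¹ j i ^ 2)) := by
        refine ht.sub (hε.mul ?_)
        exact tendsto_finsetSum _ fun i _ => tendsto_finsetSum _ fun j _ =>
          (tendsto_pi_nhds.1 (tendsto_pi_nhds.1 hH j) i).pow 2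
      rw [zero_mul, sub_zero] at this
      refine this.congr fun k => ?_
      rw [← sum_sq_mul_ridge_add (isUnit_det_ridge (toMat z) Nat.one_div_pos_of_nat)]
      ring
    have := (((ht.const_mul (Fintype.card m : ℝ)).sub hQ).sub (hL.mul ht)).sub hL
    convert this using 2
    ring

/-- The squared norm of a row and the trace of the inverse Gram matrix are negatively
correlated, in the weak form needed for integrability. -/
lemma integral_entry_sq_mul_trace_ridge_le {ε : ℝ} (hε : 0 < ε) (t : m) (i : ι) :
    ∫ z, z (t, i) * (z (t, i) * (ridge (toMat z) ε).trace) ∂gaussianEntries m ι ≤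
      Fintype.card ι * ((Fintype.card ι : ℝ) / (Fintype.card m - Fintype.card ι - 1)) := by
  classical
  have hI := integrable_entry_sq_mul_trace_ridge (m := m) (ι := ι) hε
  have hT := integrable_trace_ridge (m := m) (ι := ι) hε
  have hK := integrable_entry_mul_mul_ridge_ridge (m := m) (ι := ι) hε
  have key : ∀ i, ∫ z, z (t, i) * (z (t, i) * (ridge (toMat z) ε).trace) ∂gaussianEntries m ι =
      ∫ z, (ridge (toMat z) ε).trace ∂gaussianEntries m ι - 2 *
      ∫ z, z (t, i) * (toMat z * ridge (toMat z) ε * ridge (toMat z) ε) t i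
        ∂gaussianEntries m ι := by
    intro i
    have := integral_mul_pi_gaussianReal (t, i)
      (fun z => hasDerivAt_mul_trace_ridge z hε t i)
      (integrable_entry_mul_trace_ridge hε (t, i)) (hT.sub ((hK t i).const_mul 2)) (hI (t, i))
    refine this.trans ?_
    rw [← integral_const_mul]
    exact integral_sub hT ((hK t i).const_mul 2)
  have hpos : 0 ≤ ∑ i, ∫ z, z (t, i) *
      (toMat z * ridge (toMat z) ε * ridge (toMat z) ε) t i ∂gaussianEntries m ι := by
    rw [← integral_finsetSum _ fun i _ => hK t i]
    exact integral_nonneg fun z => sum_mul_mul_ridge_ridge_nonneg (toMat z) ε t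
  calc _ ≤ ∑ i, ∫ z, z (t, i) * (z (t, i) * (ridge (toMat z) ε).trace)
        ∂gaussianEntries m ι := by
        refine Finset.single_le_sum (f := fun i => ∫ z, z (t, i) * (z (t, i) *
          (ridge (toMat z) ε).trace) ∂gaussianEntries m ι) (fun i _ => ?_) (Finset.mem_univ i)
        refine integral_nonneg fun z => ?_
        simp only [Pi.zero_apply]
        rw [← mul_assoc]
        exact mul_nonneg (mul_self_nonneg _)
          (trace_ridge_nonneg hε.le (isUnit_det_ridge (toMat z) hε))
    _ ≤ Fintype.card ι * ∫ z, (ridge (toMat z) ε).trace ∂gaussianEntries m ι := by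
        simp only [key, Finset.sum_sub_distrib, ← Finset.mul_sum, Finset.sum_const,
          Finset.card_univ, nsmul_eq_mul]
        linarith
    _ ≤ _ := mul_le_mul_of_nonneg_left (integral_trace_ridge_le hc hε) (Nat.cast_nonneg _)

lemma integrable_entry_sq_mul_trace_inv_gram (t : m) (i : ι) :
    Integrable (fun z => z (t, i) * (z (t, i) * ((toMat z)ᵀ * toMat z)⁻¹.trace))
      (gaussianEntries m ι) := by
  refine integrable_of_tendsto_of_integral_le
    (fun k : ℕ => integrable_entry_sq_mul_trace_ridge (m := m) (ι := ι)
      (ε := 1 / ((k : ℝ) + 1)) (by positivity) (t, i))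
    (fun k z => ?_)
    (fun k => integral_entry_sq_mul_trace_ridge_le hc (by positivity) t i) ?_
  · rw [← mul_assoc]
    exact mul_nonneg (mul_self_nonneg _)
      (trace_ridge_nonneg (by positivity) (isUnit_det_ridge (toMat z) (by positivity)))
  · filter_upwards [ae_tendsto_trace_ridge hc] with z hz
    exact (hz.const_mul _).const_mul _

omit hc

/-- The matrix `Z (ZᵀZ)⁻¹` with the rows `(ZᵀZ)⁻¹ zₜ`, the transposed pseudo-inverse of `Z`:
ordinary least squares gives the response `yₜ` the weight `(ZᵀZ)⁻¹ zₜ`. -/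
noncomputable def olsWeight (Z : Matrix m ι ℝ) : Matrix m ι ℝ := Z * (Zᵀ * Z)⁻¹

lemma measurable_olsWeight (t : m) (i : ι) :
    Measurable fun z : m × ι → ℝ => olsWeight (toMat z) t i := by
  simpa only [olsWeight, ← ridge_zero] using measurable_mul_ridge 0 t i

lemma olsWeight_sq_le {Z : Matrix m ι ℝ} (h : IsUnit (Zᵀ * Z).det) (t : m) (i : ι) :
    olsWeight Z t i ^ 2 ≤ (Zᵀ * Z)⁻¹.trace := by
  have h0 : IsUnit (Zᵀ * Z + (0 : ℝ) • (1 : Matrix ι ι ℝ)).det := by simpa using h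
  rw [olsWeight, ← ridge_zero]
  exact (sq_mul_ridge_le le_rfl h0 t i).trans (ridge_diag_le_trace le_rfl h0 i)

lemma sum_olsWeight_sq {Z : Matrix m ι ℝ} (h : IsUnit (Zᵀ * Z).det) :
    ∑ t, ∑ i, olsWeight Z t i ^ 2 = (Zᵀ * Z)⁻¹.trace := by
  have h0 : IsUnit (Zᵀ * Z + (0 : ℝ) • (1 : Matrix ι ι ℝ)).det := by simpa using h
  rw [Finset.sum_comm]
  refine Finset.sum_congr rfl fun i _ => ?_
  rw [Matrix.diag_apply, ← ridge_zero, ridge_diag h0, olsWeight, ← ridge_zero]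
  simp

lemma memLp_olsWeight (hc : Fintype.card ι + 1 < Fintype.card m) (t : m) (i : ι) :
    MemLp (fun z => olsWeight (toMat z) t i) 2 (gaussianEntries m ι) := by
  rw [memLp_two_iff_integrable_sq (measurable_olsWeight t i).aestronglyMeasurable]
  refine (integrable_trace_inv_gram hc).mono'
    ((measurable_olsWeight t i).pow_const 2).aestronglyMeasurable ?_
  filter_upwards [ae_isUnit_gram hc] with z hz
  rw [Real.norm_of_nonneg (sq_nonneg _)]
  exact olsWeight_sq_le hz t i

lemma memLp_entry_mul_olsWeight (hc : Fintype.card ι + 1 < Fintype.card m) (t : m) (k i : ι) :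
    MemLp (fun z => z (t, k) * olsWeight (toMat z) t i) 2 (gaussianEntries m ι) := by
  have hm : Measurable fun z : m × ι → ℝ => z (t, k) * olsWeight (toMat z) t i :=
    (measurable_pi_apply _).mul (measurable_olsWeight t i)
  rw [memLp_two_iff_integrable_sq hm.aestronglyMeasurable]
  refine (integrable_entry_sq_mul_trace_inv_gram hc t k).mono'
    (hm.pow_const 2).aestronglyMeasurable ?_
  filter_upwards [ae_isUnit_gram hc] with z hz
  rw [Real.norm_of_nonneg (sq_nonneg _), mul_pow, ← mul_assoc, ← sq]
  exact mul_le_mul_of_nonneg_left (olsWeight_sq_le hz t i) (sq_nonneg _)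

lemma integral_sum_olsWeight_sq (hc : Fintype.card ι + 1 < Fintype.card m) :
    ∑ t, ∑ i, ∫ z, olsWeight (toMat z) t i ^ 2 ∂gaussianEntries m ι =
      (Fintype.card ι : ℝ) / (Fintype.card m - Fintype.card ι - 1) := by
  have hI := fun t i => (memLp_olsWeight (m := m) (ι := ι) hc t i).integrable_sq
  rw [← integral_trace_inv_gram hc]
  simp_rw [← integral_finsetSum _ (fun i _ => hI _ i)]
  rw [← integral_finsetSum _ (fun t _ => integrable_finsetSum _ fun i _ => hI t i)]
  refine integral_congr_ae ?_
  filter_upwards [ae_isUnit_gram hc] with z hz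
  exact sum_olsWeight_sq hz

/-- Different rows of the weights are uncorrelated: the law of `Z` is invariant under a change of
sign of one row, which leaves the Gram matrix unchanged. -/
lemma integral_olsWeight_mul_of_ne {s t : m} (hst : s ≠ t) (i j : ι) :
    ∫ z, olsWeight (toMat z) s i * olsWeight (toMat z) t j ∂gaussianEntries m ι = 0 := by
  classical
  let e : m → ℝ := fun r => if r = s then -1 else 1
  have he : ∀ r, e r * e r = 1 := fun r => by
    by_cases h : r = s <;> simp [e, h]
  have hmp : MeasurePreserving (fun (z : m × ι → ℝ) q => e q.1 * z q)
      (gaussianEntries m ι) (gaussianEntries m ι) := by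
    refine measurePreserving_pi (f := fun q : m × ι => fun x : ℝ => e q.1 * x) _ _ fun q => ?_
    refine ⟨by fun_prop, ?_⟩
    rw [gaussianReal_map_const_mul]
    congr 1
    · simp
    · ext
      simp [sq, he]
  have hW : ∀ (z : m × ι → ℝ) r k, olsWeight (toMat fun q => e q.1 * z q) r k =
      e r * olsWeight (toMat z) r k := by
    intro z r k
    have h1 : (toMat fun q => e q.1 * z q) = Matrix.diagonal e * toMat z := by
      ext a b
      simp
    have h2 : (Matrix.diagonal e * toMat z)ᵀ * (Matrix.diagonal e * toMat z) =
        (toMat z)ᵀ * toMat z := by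
      rw [Matrix.transpose_mul, Matrix.diagonal_transpose, Matrix.mul_assoc,
        ← Matrix.mul_assoc (Matrix.diagonal e), Matrix.diagonal_mul_diagonal]
      simp [he]
    rw [olsWeight, h1, h2, Matrix.mul_assoc, Matrix.diagonal_mul, olsWeight]
  have h := integral_map (μ := gaussianEntries m ι) hmp.measurable.aemeasurable
    (f := fun z => olsWeight (toMat z) s i * olsWeight (toMat z) t j)
    ((measurable_olsWeight s i).mul (measurable_olsWeight t j)).aestronglyMeasurable
  rw [hmp.map_eq] at h
  simp only [hW, e, if_true, if_neg hst.symm, one_mul, neg_mul, integral_neg] at h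
  linarith

end Moments

/-! ### Whitened coordinates -/

section Whitening

variable {n d : ℕ}

section

open scoped MatrixOrder

/-- A symmetric invertible square root of the covariance matrix, through which the Gaussian
distribution is the image of the standard one. -/
lemma exists_sqrt {S : Matrix (Fin d) (Fin d) ℝ} (hS : S.PosDef) :
    ∃ A : Matrix (Fin d) (Fin d) ℝ, Aᵀ = A ∧ A * A = S ∧ IsUnit A.det ∧
      multivariateGaussian 0 S = (stdGaussian (EuclideanSpace ℝ (Fin d))).map
        (fun v => WithLp.toLp 2 (A *ᵥ v.ofLp)) := by
  have hAA : CFC.sqrt S * CFC.sqrt S = S := CFC.sqrt_mul_sqrt_self S hS.posSemidef.nonneg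
  refine ⟨CFC.sqrt S, ?_, hAA, ?_, ?_⟩
  · have := (CFC.sqrt_nonneg S).isSelfAdjoint
    rw [IsSelfAdjoint, Matrix.star_eq_conjTranspose,
      Matrix.conjTranspose_eq_transpose_of_trivial] at this
    exact this
  · have h : IsUnit (CFC.sqrt S * CFC.sqrt S).det := by
      rw [hAA]; exact hS.det_pos.ne'.isUnit
    rw [Matrix.det_mul] at h
    exact isUnit_of_mul_isUnit_left h
  · simp only [multivariateGaussian, zero_add]
    rfl

end

/-- The entries of the whitened covariates `A⁻¹ xₜ`. -/
noncomputable def whiten (A : Matrix (Fin d) (Fin d) ℝ) (x : Fin n → EuclideanSpace ℝ (Fin d)) :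
    Fin n × Fin d → ℝ := fun q => (A⁻¹ *ᵥ (x q.1).ofLp) q.2

lemma measurable_whiten (A : Matrix (Fin d) (Fin d) ℝ) :
    Measurable (whiten (n := n) A) := by
  refine measurable_pi_lambda _ fun q => ?_
  simp only [whiten, Matrix.mulVec, dotProduct]
  fun_prop

lemma hasLaw_whiten {Ω : Type*} [MeasurableSpace Ω] {μ : Measure Ω} [IsProbabilityMeasure μ]
    {S A : Matrix (Fin d) (Fin d) ℝ} (hA : IsUnit A.det)
    (hSA : multivariateGaussian 0 S = (stdGaussian (EuclideanSpace ℝ (Fin d))).map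
        (fun v => WithLp.toLp 2 (A *ᵥ v.ofLp)))
    {x : Fin n → Ω → EuclideanSpace ℝ (Fin d)}
    (hx : ∀ t, HasLaw (x t) (multivariateGaussian 0 S) μ) (hxi : iIndepFun x μ) :
    HasLaw (fun ω => whiten A (x · ω)) (gaussianEntries (Fin n) (Fin d)) μ := by
  have hR : Measurable fun v : EuclideanSpace ℝ (Fin d) => A⁻¹ *ᵥ v.ofLp := by
    refine measurable_pi_lambda _ fun i => ?_
    simp only [Matrix.mulVec, dotProduct]
    fun_prop
  have hT : Measurable fun v : EuclideanSpace ℝ (Fin d) => WithLp.toLp 2 (A *ᵥ v.ofLp) := by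
    refine (PiLp.continuous_toLp 2 _).measurable.comp (measurable_pi_lambda _ fun i => ?_)
    simp only [Matrix.mulVec, dotProduct]
    fun_prop
  have hmap : (multivariateGaussian 0 S).map (fun v => A⁻¹ *ᵥ v.ofLp) =
      Measure.pi fun _ : Fin d => gaussianReal 0 1 := by
    rw [hSA, ← map_pi_eq_stdGaussian, Measure.map_map hT (by fun_prop),
      Measure.map_map hR (hT.comp (by fun_prop))]
    convert Measure.map_id
    ext v i
    simp [Matrix.mulVec_mulVec, Matrix.nonsing_inv_mul _ hA]
  have hrow : ∀ t, HasLaw (fun ω => A⁻¹ *ᵥ (x t ω).ofLp)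
      (Measure.pi fun _ : Fin d => gaussianReal 0 1) μ := fun t =>
    ((⟨hR, hmap⟩ : MeasurePreserving _ _ _).hasLaw).fun_comp (hx t)
  have hall := iIndepFun.hasLaw_pi hrow (hxi.comp (fun _ v => A⁻¹ *ᵥ v.ofLp) fun _ => hR)
  have hcurry : (Measure.pi fun _ : Fin n => Measure.pi fun _ : Fin d => gaussianReal 0 1).map
      (MeasurableEquiv.curry (Fin n) (Fin d) ℝ).symm = gaussianEntries (Fin n) (Fin d) := by
    have := Measure.infinitePi_map_curry_symm (fun (_ : Fin n) (_ : Fin d) => gaussianReal 0 1)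
    simp only [Measure.infinitePi_eq_pi] at this
    exact this
  exact ((⟨MeasurableEquiv.measurable _, hcurry⟩ : MeasurePreserving _ _ _).hasLaw).fun_comp hall

lemma ofLp_eq_mulVec_whiten {A : Matrix (Fin d) (Fin d) ℝ} (hA : IsUnit A.det)
    (x : Fin n → EuclideanSpace ℝ (Fin d)) (t : Fin n) :
    (x t).ofLp = A *ᵥ (toMat (whiten A x) t) := by
  have : toMat (whiten A x) t = A⁻¹ *ᵥ (x t).ofLp := rfl
  rw [this, Matrix.mulVec_mulVec, Matrix.mul_nonsing_inv _ hA, Matrix.one_mulVec]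

lemma gram_eq {A : Matrix (Fin d) (Fin d) ℝ} (hA : IsUnit A.det) (hAt : Aᵀ = A)
    (x : Fin n → EuclideanSpace ℝ (Fin d)) :
    gram x = A * ((toMat (whiten A x))ᵀ * toMat (whiten A x)) * A := by
  have h1 : gram x = (Matrix.of fun t => (x t).ofLp)ᵀ * (Matrix.of fun t => (x t).ofLp) := by
    ext i j
    simp [gram, Matrix.sum_apply, Matrix.vecMulVec_apply, Matrix.mul_apply]
  have h2 : (Matrix.of fun t => (x t).ofLp) = toMat (whiten A x) * A := by
    ext t i
    rw [Matrix.of_apply, ofLp_eq_mulVec_whiten hA x t]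
    conv_lhs => rw [← hAt]
    rw [Matrix.mulVec_transpose, hAt]
    rfl
  rw [h1, h2, Matrix.transpose_mul, hAt]
  simp only [Matrix.mul_assoc]

/-- In whitened coordinates the OLS estimator is the combination of the rows of the weight matrix
with the responses as coefficients. -/
lemma mulVec_ols {A : Matrix (Fin d) (Fin d) ℝ} (hA : IsUnit A.det) (hAt : Aᵀ = A)
    (x : Fin n → EuclideanSpace ℝ (Fin d)) (y : Fin n → ℝ) (j : Fin d) :
    (A *ᵥ ols x y) j = ∑ t, y t * olsWeight (toMat (whiten A x)) t j := by
  set Z := toMat (whiten A x) with hZ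
  have h1 : ∑ t, y t • (x t).ofLp = A *ᵥ (Zᵀ *ᵥ y) := by
    have : Zᵀ *ᵥ y = ∑ t, y t • Z t := by
      ext i
      simp only [Matrix.mulVec, dotProduct, Matrix.transpose_apply, Finset.sum_apply,
        Pi.smul_apply, smul_eq_mul]
      exact Finset.sum_congr rfl fun t _ => mul_comm _ _
    rw [this, Matrix.mulVec_sum]
    refine Finset.sum_congr rfl fun t _ => ?_
    rw [Matrix.mulVec_smul, ← ofLp_eq_mulVec_whiten hA x t]
  have h2 : A *ᵥ ols x y = (olsWeight Z)ᵀ *ᵥ y := by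
    rw [ols, h1, gram_eq hA hAt, ← hZ, Matrix.mul_inv_rev, Matrix.mul_inv_rev]
    simp only [Matrix.mulVec_mulVec]
    congr 1
    have e : (olsWeight Z)ᵀ = (Zᵀ * Z)⁻¹ * Zᵀ := by
      rw [olsWeight, Matrix.transpose_mul, Matrix.transpose_nonsing_inv, Matrix.transpose_mul,
        Matrix.transpose_transpose]
    rw [e]
    calc A * (A⁻¹ * ((Zᵀ * Z)⁻¹ * A⁻¹) * (A * Zᵀ))
        = (A * A⁻¹) * (Zᵀ * Z)⁻¹ * ((A⁻¹ * A) * Zᵀ) := by simp only [Matrix.mul_assoc]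
      _ = _ := by rw [Matrix.mul_nonsing_inv _ hA, Matrix.nonsing_inv_mul _ hA, Matrix.one_mul,
                    Matrix.one_mul]
  rw [h2]
  simp only [Matrix.mulVec, dotProduct, Matrix.transpose_apply]
  exact Finset.sum_congr rfl fun t _ => mul_comm _ _

lemma excessRisk_eq {S A : Matrix (Fin d) (Fin d) ℝ} (hAt : Aᵀ = A) (hAA : A * A = S)
    (θ θhat : Fin d → ℝ) :
    excessRisk S θ θhat = ∑ j, ((A *ᵥ θhat) j - (A *ᵥ θ) j) ^ 2 := by
  have h : excessRisk S θ θhat = (A *ᵥ (θhat - θ)) ⬝ᵥ (A *ᵥ (θhat - θ)) := by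
    rw [excessRisk, ← hAA, ← Matrix.mulVec_mulVec, Matrix.dotProduct_mulVec]
    conv_rhs => arg 1; rw [← hAt, Matrix.mulVec_transpose]
  rw [h, dotProduct_self_eq_sum_sq]
  simp [Matrix.mulVec_sub]

lemma dotProduct_eq_whiten {A : Matrix (Fin d) (Fin d) ℝ} (hA : IsUnit A.det) (hAt : Aᵀ = A)
    (x : Fin n → EuclideanSpace ℝ (Fin d)) (θ : Fin d → ℝ) (t : Fin n) :
    θ ⬝ᵥ (x t).ofLp = ∑ k, (A *ᵥ θ) k * whiten A x (t, k) := by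
  rw [ofLp_eq_mulVec_whiten hA x t, Matrix.dotProduct_mulVec]
  conv_lhs => rw [← hAt, Matrix.vecMul_transpose, hAt]
  rfl

/-- Least squares reproduces a linear response without noise. -/
lemma sum_mul_olsWeight {m ι : Type*} [Fintype m] [Fintype ι] [DecidableEq ι]
    {Z : Matrix m ι ℝ} (h : IsUnit (Zᵀ * Z).det) (β : ι → ℝ) (j : ι) :
    ∑ t, (∑ k, β k * Z t k) * olsWeight Z t j = β j := by
  have e : (Zᵀ * olsWeight Z) = 1 := by
    rw [olsWeight, ← Matrix.mul_assoc, Matrix.mul_nonsing_inv _ h]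
  have e2 : ∀ k, ∑ t, Z t k * olsWeight Z t j = (1 : Matrix ι ι ℝ) k j := by
    intro k
    rw [← e]
    rfl
  simp_rw [Finset.sum_mul]
  rw [Finset.sum_comm]
  simp_rw [mul_assoc, ← Finset.mul_sum, e2, Matrix.one_apply]
  simp

end Whitening

/-! ### Risks as second moments of independent combinations -/

section Independence

variable {Ω : Type*} [MeasurableSpace Ω] {μ : Measure Ω} [IsProbabilityMeasure μ]

omit [IsProbabilityMeasure μ] in
lemma memLp_mul_of_indepFun {f g : Ω → ℝ} (h : IndepFun f g μ) (hf : MemLp f 2 μ)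
    (hg : MemLp g 2 μ) : MemLp (fun ω => f ω * g ω) 2 μ := by
  have hm : AEStronglyMeasurable (fun ω => f ω * g ω) μ := hf.1.mul hg.1
  rw [memLp_two_iff_integrable_sq hm]
  have := (h.comp (φ := fun x : ℝ => x ^ 2) (ψ := fun x : ℝ => x ^ 2) (by fun_prop)
    (by fun_prop)).integrable_mul hf.integrable_sq hg.integrable_sq
  exact this.congr (ae_of_all _ fun ω => by simp [mul_pow])

/-- If `f` is independent of `(g, h)` and `g` of `h`, then `(f, g)` is independent of `h`. -/
lemma indepFun_prodMk_left {α β γ : Type*} [MeasurableSpace α] [MeasurableSpace β]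
    [MeasurableSpace γ] {f : Ω → α} {g : Ω → β} {h : Ω → γ} (hf : AEMeasurable f μ)
    (hg : AEMeasurable g μ) (hh : AEMeasurable h μ) (hgh : IndepFun g h μ)
    (hfgh : IndepFun f (fun ω => (g ω, h ω)) μ) :
    IndepFun (fun ω => (f ω, g ω)) h μ := by
  have hfg : IndepFun f g μ := hfgh.comp measurable_id measurable_fst
  rw [indepFun_iff_map_prod_eq_prod_map_map (by fun_prop) (by fun_prop)] at hgh hfg hfgh ⊢
  have : (fun ω => ((f ω, g ω), h ω)) =
      MeasurableEquiv.prodAssoc.symm ∘ fun ω => (f ω, (g ω, h ω)) := rfl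
  have _ := Measure.isProbabilityMeasure_map hf
  have _ := Measure.isProbabilityMeasure_map hg
  have _ := Measure.isProbabilityMeasure_map hh
  rw [this, ← AEMeasurable.map_map_of_aemeasurable (MeasurableEquiv.measurable _).aemeasurable
    (by fun_prop), hfgh, hgh, hfg]
  exact ((measurePreserving_prodAssoc _ _ _).symm _).map_eq

variable {m ι : Type*} [Fintype m] [Fintype ι] [DecidableEq ι]

omit [IsProbabilityMeasure μ] in
lemma integrable_fun_mul {f g : Ω → ℝ} (hf : MemLp f 2 μ) (hg : MemLp g 2 μ) :
    Integrable (fun ω => f ω * g ω) μ := hf.integrable_mul hg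

omit [IsProbabilityMeasure μ] in
lemma integral_add_sq {f g : Ω → ℝ} (hf : MemLp f 2 μ) (hg : MemLp g 2 μ) :
    ∫ ω, (f ω + g ω) ^ 2 ∂μ =
      ∫ ω, f ω ^ 2 ∂μ + 2 * ∫ ω, f ω * g ω ∂μ + ∫ ω, g ω ^ 2 ∂μ := by
  have hfg := (integrable_fun_mul hf hg).const_mul 2
  have hs : Integrable (fun ω => f ω ^ 2 + 2 * (f ω * g ω)) μ := hf.integrable_sq.add hfg
  rw [← integral_const_mul, ← integral_add hf.integrable_sq hfg,
    ← integral_add hs hg.integrable_sq]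
  exact integral_congr_ae (ae_of_all _ fun ω => by simp only; ring)

omit [IsProbabilityMeasure μ] in
lemma memLp_comp_of_hasLaw {α : Type*} [MeasurableSpace α] {ν : Measure α} {X : Ω → α}
    (hX : HasLaw X ν μ) {g : α → ℝ} {r : ENNReal} (hg : MemLp g r ν) :
    MemLp (fun ω => g (X ω)) r μ := by
  have h := hg
  rw [← hX.map_eq] at h
  exact h.comp_of_map hX.aemeasurable

variable {z : Ω → m × ι → ℝ}

omit [IsProbabilityMeasure μ] in
lemma memLp_sum_mul_olsWeight (hc : Fintype.card ι + 1 < Fintype.card m)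
    (hz : HasLaw z (gaussianEntries m ι) μ) {c : m → Ω → ℝ}
    (hcz : IndepFun (fun ω t => c t ω) z μ) (hc2 : ∀ t, MemLp (c t) 2 μ) (j : ι) :
    MemLp (fun ω => ∑ t, c t ω * olsWeight (toMat (z ω)) t j) 2 μ :=
  memLp_finsetSum _ fun t _ => memLp_mul_of_indepFun
    (hcz.comp (measurable_pi_apply t) (measurable_olsWeight t j)) (hc2 t)
    (memLp_comp_of_hasLaw hz (memLp_olsWeight hc t j))

omit [IsProbabilityMeasure μ] in
/-- Mean squared length of `∑ₜ cₜ wₜ` for coefficients independent of the weights `wₜ`. The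
coefficients may be correlated, because different weights are uncorrelated. -/
lemma sum_integral_sq_sum_mul_olsWeight (hc : Fintype.card ι + 1 < Fintype.card m)
    (hz : HasLaw z (gaussianEntries m ι) μ) {c : m → Ω → ℝ}
    (hcz : IndepFun (fun ω t => c t ω) z μ) (hc2 : ∀ t, MemLp (c t) 2 μ) {κ : ℝ}
    (hκ : ∀ t, ∫ ω, c t ω ^ 2 ∂μ = κ) :
    ∑ j, ∫ ω, (∑ t, c t ω * olsWeight (toMat (z ω)) t j) ^ 2 ∂μ =
      κ * ((Fintype.card ι : ℝ) / (Fintype.card m - Fintype.card ι - 1)) := by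
  classical
  have hcw : ∀ t j, MemLp (fun ω => c t ω * olsWeight (toMat (z ω)) t j) 2 μ := fun t j =>
    memLp_mul_of_indepFun (hcz.comp (measurable_pi_apply t) (measurable_olsWeight t j)) (hc2 t)
      (memLp_comp_of_hasLaw hz (memLp_olsWeight hc t j))
  have hpair : ∀ j s t, ∫ ω, (c s ω * olsWeight (toMat (z ω)) s j) *
      (c t ω * olsWeight (toMat (z ω)) t j) ∂μ =
      if s = t then κ * ∫ y, olsWeight (toMat y) t j ^ 2 ∂gaussianEntries m ι else 0 := by
    intro j s t
    have hmW : Measurable fun y : m × ι → ℝ => olsWeight (toMat y) s j * olsWeight (toMat y) t j :=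
      (measurable_olsWeight s j).mul (measurable_olsWeight t j)
    have hind := (hcz.comp (φ := fun v : m → ℝ => v s * v t) (by fun_prop)
      hmW).integral_mul_eq_mul_integral ((hc2 s).1.mul (hc2 t).1)
      (hmW.comp_aemeasurable hz.aemeasurable).aestronglyMeasurable
    have hlaw := hz.integral_comp hmW.aestronglyMeasurable
    have e : ∫ ω, (c s ω * olsWeight (toMat (z ω)) s j) *
        (c t ω * olsWeight (toMat (z ω)) t j) ∂μ = (∫ ω, c s ω * c t ω ∂μ) *
        ∫ y, olsWeight (toMat y) s j * olsWeight (toMat y) t j ∂gaussianEntries m ι := by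
      rw [← hlaw]
      refine Eq.trans ?_ hind
      refine integral_congr_ae (ae_of_all _ fun ω => ?_)
      simp only [Pi.mul_apply, Function.comp_apply]
      ring
    rw [e]
    split_ifs with h
    · subst h
      simp only [← sq, hκ]
    · rw [integral_olsWeight_mul_of_ne h, mul_zero]
  have hj : ∀ j, ∫ ω, (∑ t, c t ω * olsWeight (toMat (z ω)) t j) ^ 2 ∂μ =
      κ * ∑ t, ∫ y, olsWeight (toMat y) t j ^ 2 ∂gaussianEntries m ι := by
    intro j
    simp_rw [sq (∑ t, _), Finset.sum_mul_sum]
    have hI : ∀ s t, Integrable (fun ω => c s ω * olsWeight (toMat (z ω)) s j *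
        (c t ω * olsWeight (toMat (z ω)) t j)) μ := fun s t =>
      integrable_fun_mul (hcw s j) (hcw t j)
    rw [integral_finsetSum _ fun s _ => integrable_finsetSum _ fun t _ => hI s t,
      Finset.mul_sum]
    refine Finset.sum_congr rfl fun s _ => ?_
    rw [integral_finsetSum _ fun t _ => hI s t]
    simp only [hpair]
    simp
  simp_rw [hj]
  rw [← Finset.mul_sum, Finset.sum_comm, integral_sum_olsWeight_sq hc]

/-- The linear combinations `∑ₜ cₜ wₜ` of the weights are centred if the coefficients are. -/
lemma integral_sum_mul_olsWeight_eq_zero (hc : Fintype.card ι + 1 < Fintype.card m)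
    (hz : HasLaw z (gaussianEntries m ι) μ) {c : m → Ω → ℝ}
    (hcz : IndepFun (fun ω t => c t ω) z μ) (hc2 : ∀ t, MemLp (c t) 2 μ)
    (h0 : ∀ t, ∫ ω, c t ω ∂μ = 0) (j : ι) :
    ∫ ω, ∑ t, c t ω * olsWeight (toMat (z ω)) t j ∂μ = 0 := by
  have hI : ∀ t, Integrable (fun ω => c t ω * olsWeight (toMat (z ω)) t j) μ := fun t =>
    (memLp_mul_of_indepFun (hcz.comp (measurable_pi_apply t) (measurable_olsWeight t j)) (hc2 t)
      (memLp_comp_of_hasLaw hz (memLp_olsWeight hc t j))).integrable one_le_two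
  rw [integral_finsetSum _ fun t _ => hI t]
  refine Finset.sum_eq_zero fun t _ => ?_
  have := (hcz.comp (measurable_pi_apply t)
    (measurable_olsWeight t j)).integral_mul_eq_mul_integral (hc2 t).1
      ((measurable_olsWeight t j).comp_aemeasurable hz.aemeasurable).aestronglyMeasurable
  refine this.trans ?_
  have e : ∫ ω, ((fun v : m → ℝ => v t) ∘ fun ω t => c t ω) ω ∂μ = 0 := h0 t
  rw [e, zero_mul]

variable {η : m → Ω → ℝ}

/-- Risk of OLS on responses `αₜ (βᵀzₜ + ηₜ)` with random proportions `αₜ`, as an estimate of `p β`.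
The error is the sum of `∑ₜ (αₜ - p) (βᵀzₜ) wₜ` and `∑ₜ αₜ ηₜ wₜ`, which are uncorrelated because
`ηₜ` is centred; the bound holds for every `p`, not only for the mean of the proportions. -/
lemma integrable_and_le_bottomUp (hc : Fintype.card ι + 1 < Fintype.card m)
    (hz : HasLaw z (gaussianEntries m ι) μ) {α : m → Ω → ℝ}
    (hηz : IndepFun (fun ω t => η t ω) z μ)
    (hα : IndepFun (fun ω t => α t ω) (fun ω => ((fun t => η t ω), z ω)) μ)
    (hη2 : ∀ t, MemLp (η t) 2 μ) (hα2 : ∀ t, MemLp (α t) 2 μ) {p q v : ℝ}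
    (hη0 : ∀ t, ∫ ω, η t ω ∂μ = 0) (hηv : ∀ t, ∫ ω, η t ω ^ 2 ∂μ = v)
    (hαq : ∀ t, ∫ ω, α t ω ^ 2 ∂μ = q) (β : ι → ℝ) :
    Integrable (fun ω => ∑ j, (∑ t, (α t ω * (∑ k, β k * z ω (t, k) + η t ω)) *
      olsWeight (toMat (z ω)) t j - p * β j) ^ 2) μ ∧
    q * v * ((Fintype.card ι : ℝ) / (Fintype.card m - Fintype.card ι - 1)) ≤
      ∫ ω, ∑ j, (∑ t, (α t ω * (∑ k, β k * z ω (t, k) + η t ω)) *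
      olsWeight (toMat (z ω)) t j - p * β j) ^ 2 ∂μ := by
  have hηm : AEMeasurable (fun ω t => η t ω) μ :=
    aemeasurable_pi_lambda _ fun t => (hη2 t).1.aemeasurable
  have hαm : AEMeasurable (fun ω t => α t ω) μ :=
    aemeasurable_pi_lambda _ fun t => (hα2 t).1.aemeasurable
  have hαη : ∀ t, IndepFun (α t) (η t) μ := fun t =>
    hα.comp (measurable_pi_apply t) ((measurable_pi_apply t).comp measurable_fst)
  have hαz : IndepFun (fun ω t => α t ω) z μ := hα.comp measurable_id measurable_snd
  -- the signal part of the error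
  let u : m → ι → (m × ι → ℝ) → ℝ := fun t j y =>
    (∑ k, β k * y (t, k)) * olsWeight (toMat y) t j
  have hum : ∀ t j, Measurable (u t j) := fun t j =>
    (Finset.measurable_sum _ fun k _ => (measurable_pi_apply (t, k)).const_mul _).mul
      (measurable_olsWeight t j)
  have hu2 : ∀ t j, MemLp (fun ω => u t j (z ω)) 2 μ := by
    intro t j
    refine memLp_comp_of_hasLaw hz ?_
    have : u t j = fun y => ∑ k, β k * (y (t, k) * olsWeight (toMat y) t j) := by
      ext y
      simp only [u, Finset.sum_mul, mul_assoc]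
    rw [this]
    exact memLp_finsetSum _ fun k _ => (memLp_entry_mul_olsWeight hc t k j).const_mul _
  have hb2 : ∀ t, MemLp (fun ω => α t ω - p) 2 μ := fun t => (hα2 t).sub (memLp_const p)
  have hbu : ∀ t j, MemLp (fun ω => (α t ω - p) * u t j (z ω)) 2 μ := fun t j =>
    memLp_mul_of_indepFun (hαz.comp (φ := fun w : m → ℝ => w t - p) (by fun_prop) (hum t j))
      (hb2 t) (hu2 t j)
  have hU2 : ∀ j, MemLp (fun ω => ∑ t, (α t ω - p) * u t j (z ω)) 2 μ := fun j =>
    memLp_finsetSum _ fun t _ => hbu t j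
  -- the noise part of the error
  have hc2 : ∀ t, MemLp (fun ω => α t ω * η t ω) 2 μ := fun t =>
    memLp_mul_of_indepFun (hαη t) (hα2 t) (hη2 t)
  have hcz : IndepFun (fun ω t => α t ω * η t ω) z μ :=
    (indepFun_prodMk_left hαm hηm hz.aemeasurable hηz hα).comp
      (φ := fun r : (m → ℝ) × (m → ℝ) => fun t => r.1 t * r.2 t) (by fun_prop) measurable_id
  have hκ : ∀ t, ∫ ω, (α t ω * η t ω) ^ 2 ∂μ = q * v := by
    intro t
    rw [← hαq t, ← hηv t]
    have := ((hαη t).comp (φ := fun x : ℝ => x ^ 2) (ψ := fun x : ℝ => x ^ 2) (by fun_prop)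
      (by fun_prop)).integral_mul_eq_mul_integral (hα2 t).integrable_sq.1 (hη2 t).integrable_sq.1
    refine Eq.trans ?_ this
    exact integral_congr_ae (ae_of_all _ fun ω => by simp [mul_pow])
  have hV2 := memLp_sum_mul_olsWeight hc hz hcz hc2
  have hVsum := sum_integral_sq_sum_mul_olsWeight hc hz hcz hc2 hκ
  have hcw : ∀ t j, MemLp (fun ω => (α t ω * η t ω) * olsWeight (toMat (z ω)) t j) 2 μ :=
    fun t j => memLp_mul_of_indepFun
      (hcz.comp (measurable_pi_apply t) (measurable_olsWeight t j)) (hc2 t)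
      (memLp_comp_of_hasLaw hz (memLp_olsWeight hc t j))
  have hcross : ∀ j, ∫ ω, (∑ t, (α t ω - p) * u t j (z ω)) *
      (∑ t, (α t ω * η t ω) * olsWeight (toMat (z ω)) t j) ∂μ = 0 := by
    intro j
    simp_rw [Finset.sum_mul_sum]
    have hI : ∀ s t, Integrable (fun ω => (α s ω - p) * u s j (z ω) *
        (α t ω * η t ω * olsWeight (toMat (z ω)) t j)) μ := fun s t =>
      integrable_fun_mul (hbu s j) (hcw t j)
    rw [integral_finsetSum _ fun s _ => integrable_finsetSum _ fun t _ => hI s t]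
    refine Finset.sum_eq_zero fun s _ => ?_
    rw [integral_finsetSum _ fun t _ => hI s t]
    refine Finset.sum_eq_zero fun t _ => ?_
    have hgm : Measurable fun y : m × ι → ℝ => u s j y * olsWeight (toMat y) t j :=
      (hum s j).mul (measurable_olsWeight t j)
    have hgm' : AEStronglyMeasurable (fun ω => u s j (z ω) * olsWeight (toMat (z ω)) t j) μ :=
      (hgm.comp_aemeasurable hz.aemeasurable).aestronglyMeasurable
    have h1 := (hηz.comp (measurable_pi_apply t) hgm).integral_mul_eq_mul_integral (hη2 t).1 hgm'
    have h2 := (hα.comp (φ := fun w : m → ℝ => (w s - p) * w t) (by fun_prop)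
      (ψ := fun r : (m → ℝ) × (m × ι → ℝ) => r.1 t * (u s j r.2 * olsWeight (toMat r.2) t j))
      (((measurable_pi_apply t).comp measurable_fst).mul
        (hgm.comp measurable_snd))).integral_mul_eq_mul_integral ((hb2 s).1.mul (hα2 t).1)
        ((hη2 t).1.mul hgm')
    have e : ∫ ω, η t ω * (u s j (z ω) * olsWeight (toMat (z ω)) t j) ∂μ = 0 := by
      refine h1.trans ?_
      have e0 : ∫ ω, ((fun w : m → ℝ => w t) ∘ fun ω t => η t ω) ω ∂μ = 0 := hη0 t
      rw [e0, zero_mul]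
    have e2 : ∫ ω, ((α s ω - p) * α t ω) *
        (η t ω * (u s j (z ω) * olsWeight (toMat (z ω)) t j)) ∂μ = 0 := by
      refine h2.trans ?_
      refine mul_eq_zero_of_right _ e
    rw [← e2]
    exact integral_congr_ae (ae_of_all _ fun ω => by simp only; ring)
  have hae : ∀ᵐ ω ∂μ, ∀ j, ∑ t, (α t ω * (∑ k, β k * z ω (t, k) + η t ω)) *
      olsWeight (toMat (z ω)) t j - p * β j =
      ∑ t, (α t ω - p) * u t j (z ω) + ∑ t, (α t ω * η t ω) * olsWeight (toMat (z ω)) t j := by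
    have hinv : ∀ᵐ ω ∂μ, IsUnit ((toMat (z ω))ᵀ * toMat (z ω)).det := by
      have h := ae_isUnit_gram hc
      rw [← hz.map_eq] at h
      exact ae_of_ae_map hz.aemeasurable h
    filter_upwards [hinv] with ω hω j
    have h := sum_mul_olsWeight hω β j
    rw [← h, Finset.mul_sum, ← Finset.sum_sub_distrib, ← Finset.sum_add_distrib]
    refine Finset.sum_congr rfl fun t _ => ?_
    simp only [u, toMat_apply]
    ring
  have hI : ∀ j, Integrable (fun ω => (∑ t, (α t ω * (∑ k, β k * z ω (t, k) + η t ω)) *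
      olsWeight (toMat (z ω)) t j - p * β j) ^ 2) μ := fun j =>
    ((hU2 j).add (hV2 j)).integrable_sq.congr (hae.mono fun ω hω => by
      simp only [Pi.add_apply, hω j])
  refine ⟨integrable_finsetSum _ fun j _ => hI j, ?_⟩
  rw [integral_finsetSum _ fun j _ => hI j, ← hVsum]
  refine Finset.sum_le_sum fun j _ => ?_
  have hU0 : 0 ≤ ∫ ω, (∑ t, (α t ω - p) * u t j (z ω)) ^ 2 ∂μ :=
    integral_nonneg fun ω => sq_nonneg _
  have e : ∫ ω, (∑ t, (α t ω * (∑ k, β k * z ω (t, k) + η t ω)) *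
      olsWeight (toMat (z ω)) t j - p * β j) ^ 2 ∂μ =
      ∫ ω, (∑ t, (α t ω - p) * u t j (z ω) +
        ∑ t, (α t ω * η t ω) * olsWeight (toMat (z ω)) t j) ^ 2 ∂μ :=
    integral_congr_ae (hae.mono fun ω hω => by simp only [hω j])
  rw [e, integral_add_sq (hU2 j) (hV2 j), hcross j]
  linarith

/-- Risk of the OLS estimate on the responses `βᵀzₜ + ηₜ` multiplied by an independent random
proportion `φ` of mean `p` and variance `w`. -/
lemma integrable_and_eq_topDown (hc : Fintype.card ι + 1 < Fintype.card m)
    (hz : HasLaw z (gaussianEntries m ι) μ) {φ : Ω → ℝ}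
    (hηz : IndepFun (fun ω t => η t ω) z μ)
    (hφ : IndepFun φ (fun ω => ((fun t => η t ω), z ω)) μ)
    (hη2 : ∀ t, MemLp (η t) 2 μ) (hφ2 : MemLp φ 2 μ) {p w v : ℝ}
    (hη0 : ∀ t, ∫ ω, η t ω ∂μ = 0) (hηv : ∀ t, ∫ ω, η t ω ^ 2 ∂μ = v)
    (hφp : ∫ ω, φ ω ∂μ = p) (hφw : Var[φ; μ] = w) (β : ι → ℝ) :
    Integrable (fun ω => ∑ j, (φ ω * ∑ t, (∑ k, β k * z ω (t, k) + η t ω) *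
      olsWeight (toMat (z ω)) t j - p * β j) ^ 2) μ ∧
    ∫ ω, ∑ j, (φ ω * ∑ t, (∑ k, β k * z ω (t, k) + η t ω) *
      olsWeight (toMat (z ω)) t j - p * β j) ^ 2 ∂μ =
      w * ∑ j, β j ^ 2 +
      (w + p ^ 2) * (v * ((Fintype.card ι : ℝ) / (Fintype.card m - Fintype.card ι - 1))) := by
  have hV2 := memLp_sum_mul_olsWeight hc hz hηz hη2
  have hVsum := sum_integral_sq_sum_mul_olsWeight hc hz hηz hη2 hηv
  have hV0 := integral_sum_mul_olsWeight_eq_zero hc hz hηz hη2 hη0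
  set V : ι → Ω → ℝ := fun j ω => ∑ t, η t ω * olsWeight (toMat (z ω)) t j
  have hφV : ∀ j, IndepFun φ (V j) μ := fun j =>
    hφ.comp measurable_id (ψ := fun r : (m → ℝ) × (m × ι → ℝ) =>
      ∑ t, r.1 t * olsWeight (toMat r.2) t j)
      (Finset.measurable_sum _ fun t _ => ((measurable_pi_apply t).comp measurable_fst).mul
        ((measurable_olsWeight t j).comp measurable_snd))
  have hφsq : ∫ ω, φ ω ^ 2 ∂μ = w + p ^ 2 := by
    have := variance_eq_sub hφ2
    rw [hφw, hφp] at this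
    have e : ∫ ω, (φ ^ 2) ω ∂μ = ∫ ω, φ ω ^ 2 ∂μ := rfl
    rw [e] at this
    linarith
  have hdev : ∫ ω, (φ ω - p) ^ 2 ∂μ = w := by
    rw [← hφw, variance_eq_integral hφ2.1.aemeasurable, hφp]
  have hd2 : MemLp (fun ω => φ ω - p) 2 μ := hφ2.sub (memLp_const p)
  have hae : ∀ᵐ ω ∂μ, ∀ j, φ ω * ∑ t, (∑ k, β k * z ω (t, k) + η t ω) *
      olsWeight (toMat (z ω)) t j - p * β j = (φ ω - p) * β j + φ ω * V j ω := by
    have hinv : ∀ᵐ ω ∂μ, IsUnit ((toMat (z ω))ᵀ * toMat (z ω)).det := by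
      have h := ae_isUnit_gram hc
      rw [← hz.map_eq] at h
      exact ae_of_ae_map hz.aemeasurable h
    filter_upwards [hinv] with ω hω j
    have h := sum_mul_olsWeight hω β j
    simp only [toMat_apply] at h
    simp only [add_mul, Finset.sum_add_distrib, h, V]
    ring
  have hφV2 : ∀ j, MemLp (fun ω => φ ω * V j ω) 2 μ := fun j =>
    memLp_mul_of_indepFun (hφV j) hφ2 (hV2 j)
  have hdβ : ∀ j, MemLp (fun ω => (φ ω - p) * β j) 2 μ := fun j => hd2.mul_const _
  have hI : ∀ j, Integrable (fun ω => (φ ω * ∑ t, (∑ k, β k * z ω (t, k) + η t ω) *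
      olsWeight (toMat (z ω)) t j - p * β j) ^ 2) μ := fun j =>
    ((hdβ j).add (hφV2 j)).integrable_sq.congr (hae.mono fun ω hω => by
      simp only [Pi.add_apply, hω j])
  refine ⟨integrable_finsetSum _ fun j _ => hI j, ?_⟩
  rw [integral_finsetSum _ fun j _ => hI j, ← hVsum, Finset.mul_sum, Finset.mul_sum,
    ← Finset.sum_add_distrib]
  refine Finset.sum_congr rfl fun j _ => ?_
  have hcross : ∫ ω, ((φ ω - p) * β j) * (φ ω * V j ω) ∂μ = 0 := by
    have h1 := ((hφV j).comp (φ := fun x : ℝ => (x - p) * β j * x) (by fun_prop)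
      measurable_id).integral_mul_eq_mul_integral ((hdβ j).1.mul hφ2.1) (hV2 j).1
    have e : ∫ ω, (id ∘ V j) ω ∂μ = 0 := hV0 j
    rw [e, mul_zero] at h1
    rw [← h1]
    exact integral_congr_ae (ae_of_all _ fun ω => by
      simp only [Pi.mul_apply, Function.comp_apply, id]; ring)
  have hsq : ∫ ω, (φ ω * V j ω) ^ 2 ∂μ = (w + p ^ 2) * ∫ ω, V j ω ^ 2 ∂μ := by
    rw [← hφsq]
    have := ((hφV j).comp (φ := fun x : ℝ => x ^ 2) (ψ := fun x : ℝ => x ^ 2) (by fun_prop)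
      (by fun_prop)).integral_mul_eq_mul_integral hφ2.integrable_sq.1 (hV2 j).integrable_sq.1
    refine Eq.trans ?_ this
    exact integral_congr_ae (ae_of_all _ fun ω => by simp [mul_pow])
  have e : ∫ ω, (φ ω * ∑ t, (∑ k, β k * z ω (t, k) + η t ω) *
      olsWeight (toMat (z ω)) t j - p * β j) ^ 2 ∂μ =
      ∫ ω, ((φ ω - p) * β j + φ ω * V j ω) ^ 2 ∂μ :=
    integral_congr_ae (hae.mono fun ω hω => by simp only [hω j])
  rw [e, integral_add_sq (hdβ j) (hφV2 j), hcross, hsq]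
  simp_rw [mul_pow]
  rw [integral_mul_const, hdev]
  ring

omit [DecidableEq ι] in
/-- A nonzero linear functional of a Gaussian row, plus independent noise, has no atom at `0`. -/
lemma ae_sum_mul_add_ne_zero (hz : HasLaw z (gaussianEntries m ι) μ)
    (hηz : IndepFun (fun ω t => η t ω) z μ) (hηm : ∀ t, AEMeasurable (η t) μ)
    {β : ι → ℝ} (hβ : β ≠ 0) (t : m) :
    ∀ᵐ ω ∂μ, ∑ k, β k * z ω (t, k) + η t ω ≠ 0 := by
  classical
  obtain ⟨k, hk⟩ := Function.ne_iff.1 hβ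
  have hL : Measurable fun y : m × ι → ℝ => ∑ i, β i * y (t, i) := by fun_prop
  have hnull : ∀ c : ℝ, gaussianEntries m ι {y | ∑ i, β i * y (t, i) = c} = 0 := by
    intro c
    have hms : MeasurableSet {y : m × ι → ℝ | ∑ i, β i * y (t, i) = c} :=
      hL (measurableSet_singleton c)
    have mp := measurePreserving_update (fun _ : m × ι => gaussianReal 0 1) (t, k)
    have h := mp.measure_preimage hms.nullMeasurableSet
    have h' : gaussianEntries m ι {y | ∑ i, β i * y (t, i) = c} =
      Measure.pi (fun _ : m × ι => gaussianReal 0 1) {y | ∑ i, β i * y (t, i) = c} := rfl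
    rw [h', ← h, Measure.measure_prod_null (mp.measurable hms)]
    refine ae_of_all _ fun y => ?_
    have := nullSingletonClass_gaussianReal (μ := 0) (v := 1) one_ne_zero
    refine Set.Subsingleton.measure_zero (fun s₁ h₁ s₂ h₂ => ?_) _
    simp only [Set.mem_preimage, Set.mem_ofPred_eq] at h₁ h₂
    have hsplit : ∀ s, ∑ i, β i * Function.update y (t, k) s (t, i) =
        β k * s + ∑ i ∈ Finset.univ.erase k, β i * y (t, i) := by
      intro s
      rw [← Finset.add_sum_erase _ _ (Finset.mem_univ k), Function.update_self]
      congr 1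
      refine Finset.sum_congr rfl fun i hi => ?_
      rw [Function.update_of_ne]
      intro h
      exact Finset.ne_of_mem_erase hi (Prod.ext_iff.1 h).2
    rw [hsplit] at h₁ h₂
    have : β k * s₁ = β k * s₂ := by linarith
    exact mul_left_cancel₀ hk this
  have hind : IndepFun (η t) z μ := hηz.comp (measurable_pi_apply t) measurable_id
  rw [indepFun_iff_map_prod_eq_prod_map_map (hηm t) hz.aemeasurable, hz.map_eq] at hind
  have hm2 : Measurable fun r : ℝ × (m × ι → ℝ) => ∑ i, β i * r.2 (t, i) + r.1 := by fun_prop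
  have hprod : ∀ᵐ r ∂(μ.map (η t)).prod (gaussianEntries m ι),
      ∑ i, β i * r.2 (t, i) + r.1 ≠ 0 := by
    rw [ae_iff]
    simp only [ne_eq, not_not]
    have _ := Measure.isProbabilityMeasure_map (hηm t)
    have hms : MeasurableSet {r : ℝ × (m × ι → ℝ) | ∑ i, β i * r.2 (t, i) + r.1 = 0} :=
      hm2 (measurableSet_singleton 0)
    rw [Measure.measure_prod_null hms]
    refine ae_of_all _ fun s => ?_
    refine measure_mono_null (fun y hy => ?_) (hnull (-s))
    simp only [Set.mem_preimage, Set.mem_ofPred_eq] at hy ⊢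
    have hy' : ∑ i, β i * y (t, i) + s = 0 := hy
    linarith
  rw [← hind] at hprod
  exact ae_of_ae_map ((hηm t).prodMk hz.aemeasurable) hprod

end Independence

end TwoLevel

theorem theorem1 {Ω : Type*} [MeasurableSpace Ω] (μ : Measure Ω) [IsProbabilityMeasure μ]
    (n d K : ℕ) (hn : d + 1 < n)
    (S : Matrix (Fin d) (Fin d) ℝ) (hS : S.PosDef) (θ₀ : Fin d → ℝ) (σ : ℝ)
    (P : Measure (Fin K → ℝ)) (p s : Fin K → ℝ)
    -- mean and variance of the coordinates of the proportion distribution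
    (hP : ∀ i, MemLp (fun v : Fin K → ℝ => v i) 2 P)
    (hp : ∀ i, ∫ v, v i ∂P = p i)
    (hs : ∀ i, Var[fun v : Fin K → ℝ => v i; P] = s i)
    (x : Fin n → Ω → EuclideanSpace ℝ (Fin d)) (η : Fin n → Ω → ℝ) (a : Fin n → Ω → Fin K → ℝ)
    -- covariates: independent draws from `N(0, S)`
    (hx : ∀ t, HasLaw (x t) (multivariateGaussian 0 S) μ)
    (hxi : iIndepFun x μ)
    -- noise: centred with variance `σ²`, independent of the covariates
    (hη : ∀ t, MemLp (η t) 2 μ)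
    (hη0 : ∀ t, ∫ ω, η t ω ∂μ = 0)
    (hησ : ∀ t, Var[η t; μ] = σ ^ 2)
    (hηx : IndepFun (fun ω t => η t ω) (fun ω t => x t ω) μ)
    -- proportions: independent draws from `P`, independent of the covariates and the noise
    (ha : ∀ t, HasLaw (a t) P μ)
    (hai : iIndepFun a μ)
    (haxη : IndepFun (fun ω t => a t ω) (fun ω => ((fun t => x t ω), (fun t => η t ω))) μ) :
    ((∀ i, Integrable (fun ω => TwoLevel.excessRisk S (p i • θ₀)
          (TwoLevel.bottomUp θ₀ (x · ω) (η · ω) (a · ω) i)) μ) ∧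
      ∑ i, (s i + p i ^ 2) * ((d : ℝ) / ((n : ℝ) - d - 1)) * σ ^ 2 ≤
        ∑ i, ∫ ω, TwoLevel.excessRisk S (p i • θ₀)
          (TwoLevel.bottomUp θ₀ (x · ω) (η · ω) (a · ω) i) ∂μ) ∧
    -- the ratios `y_{t,i} / y_{t,0}` are almost surely defined
    ((θ₀ ≠ 0 ∨ ∀ t, ∀ᵐ ω ∂μ, η t ω ≠ 0) →
      (∀ i, Integrable (fun ω => TwoLevel.excessRisk S (p i • θ₀)
          (TwoLevel.topDown θ₀ (x · ω) (η · ω) (a · ω) i)) μ) ∧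
      ∑ i, ∫ ω, TwoLevel.excessRisk S (p i • θ₀)
          (TwoLevel.topDown θ₀ (x · ω) (η · ω) (a · ω) i) ∂μ =
        (∑ i, s i) / n * (θ₀ ⬝ᵥ S *ᵥ θ₀) +
          ((∑ i, s i) / n + ∑ i, p i ^ 2) * ((d : ℝ) / ((n : ℝ) - d - 1)) * σ ^ 2) := by
  obtain ⟨A, hAt, hAA, hA, hSA⟩ := TwoLevel.exists_sqrt hS
  have hz := TwoLevel.hasLaw_whiten hA hSA hx hxi
  set z : Ω → Fin n × Fin d → ℝ := fun ω => TwoLevel.whiten A (x · ω) with hzdef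
  have hwm := TwoLevel.measurable_whiten (n := n) A
  have hc : Fintype.card (Fin d) + 1 < Fintype.card (Fin n) := by simpa using hn
  have hηz : IndepFun (fun ω t => η t ω) z μ := hηx.comp measurable_id hwm
  have haη : IndepFun (fun ω t => a t ω) (fun ω => ((fun t => η t ω), z ω)) μ :=
    haxη.comp measurable_id
      (ψ := fun r : (Fin n → EuclideanSpace ℝ (Fin d)) × (Fin n → ℝ) =>
        (r.2, TwoLevel.whiten A r.1))
      (measurable_snd.prodMk (hwm.comp measurable_fst))
  have hηv : ∀ t, ∫ ω, η t ω ^ 2 ∂μ = σ ^ 2 := fun t => by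
    rw [← hησ t, variance_of_integral_eq_zero (hη t).1.aemeasurable (hη0 t)]
  have ha2 : ∀ i t, MemLp (fun ω => a t ω i) 2 μ := fun i t =>
    TwoLevel.memLp_comp_of_hasLaw (ha t) (hP i)
  have hap : ∀ i t, ∫ ω, a t ω i ∂μ = p i := fun i t => by
    rw [← hp i]
    exact (ha t).integral_comp (hP i).1
  have hav : ∀ i t, Var[fun ω => a t ω i; μ] = s i := fun i t => by
    have h := (hP i).1.aemeasurable
    rw [← (ha t).map_eq] at h
    rw [← hs i, ← (ha t).map_eq, variance_map h (ha t).aemeasurable]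
    rfl
  have haq : ∀ i t, ∫ ω, a t ω i ^ 2 ∂μ = s i + p i ^ 2 := fun i t => by
    have h := variance_eq_sub (ha2 i t)
    rw [hav i t, hap i t] at h
    have e : ∫ ω, ((fun ω => a t ω i) ^ 2) ω ∂μ = ∫ ω, a t ω i ^ 2 ∂μ := rfl
    rw [e] at h
    linarith
  have hroot : ∀ t ω, TwoLevel.rootValue θ₀ (x t ω) (η t ω) =
      ∑ k, (A *ᵥ θ₀) k * z ω (t, k) + η t ω := fun t ω => by
    rw [TwoLevel.rootValue, TwoLevel.dotProduct_eq_whiten hA hAt (x · ω) θ₀ t]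
  have hrisk : ∀ i (f : Fin d → ℝ), TwoLevel.excessRisk S (p i • θ₀) f =
      ∑ j, ((A *ᵥ f) j - p i * (A *ᵥ θ₀) j) ^ 2 := fun i f => by
    rw [TwoLevel.excessRisk_eq hAt hAA, Matrix.mulVec_smul]
    rfl
  have hcols : ∀ i, IndepFun (fun ω t => a t ω i) (fun ω => ((fun t => η t ω), z ω)) μ := fun i =>
    haη.comp (φ := fun (w : Fin n → Fin K → ℝ) t => w t i) (by fun_prop) measurable_id
  refine ⟨?_, fun hne => ?_⟩
  · have hb : ∀ i ω, TwoLevel.excessRisk S (p i • θ₀)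
        (TwoLevel.bottomUp θ₀ (x · ω) (η · ω) (a · ω) i) =
        ∑ j, (∑ t, (a t ω i * (∑ k, (A *ᵥ θ₀) k * z ω (t, k) + η t ω)) *
          TwoLevel.olsWeight (TwoLevel.toMat (z ω)) t j - p i * (A *ᵥ θ₀) j) ^ 2 := by
      intro i ω
      rw [hrisk]
      simp only [TwoLevel.bottomUp, TwoLevel.mulVec_ols hA hAt, TwoLevel.childValue, hroot]
      rfl
    have key := fun i => TwoLevel.integrable_and_le_bottomUp hc hz (α := fun t ω => a t ω i)
      hηz (hcols i) hη (ha2 i) (p := p i) hη0 hηv (haq i) (A *ᵥ θ₀)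
    simp only [hb]
    refine ⟨fun i => (key i).1, Finset.sum_le_sum fun i _ => ?_⟩
    refine le_trans (le_of_eq ?_) (key i).2
    simp only [Fintype.card_fin]
    ring
  · have hn0 : (n : ℝ) ≠ 0 := by
      have : 0 < n := by omega
      positivity
    have hy : ∀ᵐ ω ∂μ, ∀ t, TwoLevel.rootValue θ₀ (x t ω) (η t ω) ≠ 0 := by
      rw [ae_all_iff]
      intro t
      simp only [hroot]
      by_cases hθ : θ₀ = 0
      · filter_upwards [(hne.resolve_left (not_not.2 hθ)) t] with ω hω
        simpa [hθ] using hω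
      · refine TwoLevel.ae_sum_mul_add_ne_zero hz hηz (fun t => (hη t).1.aemeasurable) ?_ t
        intro h0
        refine hθ ?_
        have h := congrArg (fun v => A⁻¹ *ᵥ v) h0
        simpa [Matrix.mulVec_mulVec, Matrix.nonsing_inv_mul _ hA] using h
    let phat : Fin K → Ω → ℝ := fun i ω => 1 / (n : ℝ) * ∑ t, a t ω i
    have hphat2 : ∀ i, MemLp (phat i) 2 μ := fun i =>
      (memLp_finsetSum _ fun t _ => ha2 i t).const_mul _
    have hphatp : ∀ i, ∫ ω, phat i ω ∂μ = p i := fun i => by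
      simp only [phat]
      rw [integral_const_mul, integral_finsetSum _ fun t _ => (ha2 i t).integrable one_le_two]
      simp only [hap, Finset.sum_const, Finset.card_univ, Fintype.card_fin, nsmul_eq_mul]
      field_simp
    have hphatv : ∀ i, Var[phat i; μ] = s i / n := fun i => by
      have hsum := IndepFun.variance_sum (s := Finset.univ) (fun t _ => ha2 i t)
        (fun t _ t' _ htt => (hai.indepFun htt).comp (measurable_pi_apply i) (measurable_pi_apply i))
      have e : phat i = fun ω => 1 / (n : ℝ) * (∑ t, fun ω => a t ω i) ω := by
        ext ω
        simp [phat, Finset.sum_apply]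
      rw [e, variance_const_mul, hsum]
      simp only [hav, Finset.sum_const, Finset.card_univ, Fintype.card_fin, nsmul_eq_mul]
      field_simp
    have hphati : ∀ i, IndepFun (phat i) (fun ω => ((fun t => η t ω), z ω)) μ := fun i =>
      (hcols i).comp (φ := fun w : Fin n → ℝ => 1 / (n : ℝ) * ∑ t, w t) (by fun_prop)
        measurable_id
    have ht : ∀ᵐ ω ∂μ, ∀ i, TwoLevel.excessRisk S (p i • θ₀)
        (TwoLevel.topDown θ₀ (x · ω) (η · ω) (a · ω) i) =
        ∑ j, (phat i ω * ∑ t, (∑ k, (A *ᵥ θ₀) k * z ω (t, k) + η t ω) *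
          TwoLevel.olsWeight (TwoLevel.toMat (z ω)) t j - p i * (A *ᵥ θ₀) j) ^ 2 := by
      filter_upwards [hy] with ω hω i
      have hm : TwoLevel.meanProportion θ₀ (x · ω) (η · ω) (a · ω) i = phat i ω := by
        simp only [TwoLevel.meanProportion, TwoLevel.childValue, phat]
        congr 1
        exact Finset.sum_congr rfl fun t _ => mul_div_cancel_right₀ _ (hω t)
      rw [hrisk, TwoLevel.topDown, hm, Matrix.mulVec_smul]
      simp only [Pi.smul_apply, smul_eq_mul, TwoLevel.mulVec_ols hA hAt, hroot]
      rfl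
    have key := fun i => TwoLevel.integrable_and_eq_topDown hc hz hηz (hphati i) hη (hphat2 i)
      hη0 hηv (hphatp i) (hphatv i) (A *ᵥ θ₀)
    have hnorm : θ₀ ⬝ᵥ S *ᵥ θ₀ = ∑ j, (A *ᵥ θ₀) j ^ 2 := by
      have h := TwoLevel.excessRisk_eq hAt hAA 0 θ₀
      simpa [TwoLevel.excessRisk] using h
    refine ⟨fun i => (key i).1.congr (ht.mono fun ω hω => (hω i).symm), ?_⟩
    have hi : ∀ i, ∫ ω, TwoLevel.excessRisk S (p i • θ₀)
        (TwoLevel.topDown θ₀ (x · ω) (η · ω) (a · ω) i) ∂μ =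
        s i / n * (θ₀ ⬝ᵥ S *ᵥ θ₀) + (s i / n + p i ^ 2) *
          (σ ^ 2 * ((d : ℝ) / ((n : ℝ) - d - 1))) := fun i => by
      rw [integral_congr_ae (ht.mono fun ω hω => hω i), (key i).2, hnorm]
      simp only [Fintype.card_fin]
    simp only [hi, Finset.sum_add_distrib, ← Finset.sum_mul, ← Finset.sum_div]
    ring
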